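/- **Setting.** Let $(\Omega,\mathcal F,\mathrm p)$ be a probability space, $d$ a natural number, and $M:\Omega\to M_d(\mathbb C)$ a measurable map such that 1. there is a norm $|||\cdot|||$ on $\mathbb C^d$ with $|||M(\omega)x|||\le|||x|||$ for all $\omega\in\Omega$ and $x\in\mathbb C^d$; 2. there is a vector $\psi_S\in\mathbb C^d$ of Euclidean norm $1$, not depending on $\omega$, with $M(\omega)\psi_S=\psi_S$ for all $\omega\in\Omega$. Inner products are linear in the second argument, and $|x\rangle\langle y|$ is the operator $\chi\mapsto\langle y,\chi\rangle x$. The spectral projection of a matrix $A$ for the eigenvalue $1$ is the projection onto the generalized eigenspace of $A$ for $1$ along the sum of the generalized eigenspaces of $A$ for all other eigenvalues; denote it by $P_{1,A}$. Put $$\psi(\omega)=P_{1,M(\omega)}^*\,\psi_S,\qquad Q(\omega)=1-|\psi_S\rangle\langle\psi(\omega)|,\qquad M_Q(\omega)=Q(\omega)M(\omega)Q(\omega).$$ Let $\mathcal M_{(E)}$ be the set of matrices $A\in M_d(\mathbb C)$ that satisfy $|||Ax|||\le|||x|||$ for all $x$ and $A\psi_S=\psi_S$, and for which $1$ is a simple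 eigenvalue and the only point of the spectrum on the complex unit circle. On $\Omega^{\mathbb N^*}$, where $\mathbb N^*=\{1,2,\dots\}$, let $\mathbb P$ be the infinite product measure $\prod_{j\ge1}\mathrm p$, and for $\overline\omega=(\omega_1,\omega_2,\dots)\in\Omega^{\mathbb N^*}$ and $n\ge1$ put $$\theta_n(\overline\omega)=M^*(\omega_n)\cdots M^*(\omega_2)\,\psi(\omega_1).$$ $\mathbb E[f]=\int_\Omega f\,d\mathrm p$ denotes the (entrywise) expectation of a random vector or matrix. **Theorem (fluctuating process).** Suppose that $\mathrm p\big(M(\omega)\in\mathcal M_{(E)}\big)>0$. Then $M$, $M_Q$ and $\psi$ are integrable, $\mathbb E[M]\in\mathcal M_{(E)}$, the matrix $1-\mathbb E[M_Q]^*$ is invertible, and for $\mathbb P$-almost every $\overline\omega\in\Omega^{\mathbb N^*}$ $$\lim_{N\to\infty}\frac1N\sum_{n=1}^N\theta_n(\overline\omega)=\theta,$$ where $$\theta=\big(1-\mathbb E[M_Q]^*\big)^{-1}\mathbb E[\psi]=P_{1,\mathbb E[M]}^*\,\mathbb E[\psi]=P_{1,\mathbb E[M]}^*\,\psi_S .$$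 -/

import Mathlib

open MeasureTheory Filter Topology Matrix

namespace RandomProduct

noncomputable section

variable {d : ℕ} {Ω : Type*}

/-- Over `ℂ`, the generalized eigenspace of `f` for `μ` is complementary to the sum of the
generalized eigenspaces for all the other eigenvalues. -/
theorem isCompl_maxGenEigenspace (f : Module.End ℂ (Fin d → ℂ)) (μ : ℂ) :
    IsCompl (f.maxGenEigenspace μ) (⨆ ν, ⨆ _ : ν ≠ μ, f.maxGenEigenspace ν) := by
  refine ⟨f.independent_maxGenEigenspace μ, ?_⟩
  rw [codisjoint_iff, eq_top_iff, ← f.iSup_maxGenEigenspace_eq_top]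
  refine iSup_le fun ν => ?_
  by_cases h : ν = μ
  · subst h
    exact le_sup_left
  · exact le_sup_of_le_right (le_iSup₂_of_le ν h le_rfl)

/-- The spectral (Riesz) projection of the matrix `A` for `μ`: the projection onto the generalized
eigenspace of `A` for `μ` along the sum of the generalized eigenspaces for all other eigenvalues. -/
def spectralProj (A : Matrix (Fin d) (Fin d) ℂ) (μ : ℂ) : Matrix (Fin d) (Fin d) ℂ :=
  LinearMap.toMatrix' (Submodule.projection _ _ (isCompl_maxGenEigenspace (Matrix.toLin' A) μ))

/-- `|x⟩⟨y|`, the matrix of `χ ↦ ⟨y, χ⟩ x`, with `⟨·,·⟩` linear in the second argument. -/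
def ketBra (x y : Fin d → ℂ) : Matrix (Fin d) (Fin d) ℂ := Matrix.vecMulVec x (star y)

/-- A (constant) reduced dynamics operator for the norm `N` and the vector `ψS`: a matrix that does
not increase `N` and leaves `ψS` invariant. -/
structure IsRDO (N : Seminorm ℂ (Fin d → ℂ)) (ψS : Fin d → ℂ)
    (A : Matrix (Fin d) (Fin d) ℂ) : Prop where
  contraction : ∀ x, N (A *ᵥ x) ≤ N x
  invariant : A *ᵥ ψS = ψS

/-- A random reduced dynamics operator: a random matrix (measurable in `ω`), all of whose values are
contractions for one and the same norm `N` on `ℂ^d` and fix one and the same vector `ψS`, which is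
normalized in the Euclidean norm. -/
structure IsRRDO [MeasurableSpace Ω] (N : Seminorm ℂ (Fin d → ℂ)) (ψS : Fin d → ℂ)
    (M : Ω → Matrix (Fin d) (Fin d) ℂ) : Prop where
  measurable : ∀ i j, Measurable fun ω => M ω i j
  isNorm : ∀ x, N x = 0 → x = 0
  normalized : ‖WithLp.toLp 2 ψS‖ = 1
  isRDO : ∀ ω, IsRDO N ψS (M ω)

/-- The set `𝓜_(E)`: the reduced dynamics operators for which `1` is a simple eigenvalue and the only
point of the spectrum on the complex unit circle. -/
def ergodicSet (N : Seminorm ℂ (Fin d → ℂ)) (ψS : Fin d → ℂ) :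
    Set (Matrix (Fin d) (Fin d) ℂ) :=
  {A | IsRDO N ψS A ∧ A.charpoly.rootMultiplicity 1 = 1 ∧ ∀ z ∈ spectrum ℂ A, ‖z‖ = 1 → z = 1}

/-- `ψ = P₁* ψS`, where `P₁` is the spectral projection of `A` for the eigenvalue `1`. -/
def psi (ψS : Fin d → ℂ) (A : Matrix (Fin d) (Fin d) ℂ) : Fin d → ℂ :=
  (spectralProj A 1)ᴴ *ᵥ ψS

/-- `M_Q = Q M Q`, where `Q = 1 - |ψS⟩⟨ψ|`. -/
def partQ (ψS : Fin d → ℂ) (A : Matrix (Fin d) (Fin d) ℂ) : Matrix (Fin d) (Fin d) ℂ :=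
  (1 - ketBra ψS (psi ψS A)) * A * (1 - ketBra ψS (psi ψS A))

/-- The fluctuating process. Sequences in `Ω` are indexed from `0`, so that `ω 0, ω 1, …` are the
random parameters `ω₁, ω₂, …`, and `theta M ψS ω n` is `θ_{n+1} = M*(ω_{n+1}) ⋯ M*(ω₂) ψ(ω₁)`. -/
def theta (M : Ω → Matrix (Fin d) (Fin d) ℂ) (ψS : Fin d → ℂ) (ω : ℕ → Ω) : ℕ → Fin d → ℂ
  | 0 => psi ψS (M (ω 0))
  | n + 1 => (M (ω (n + 1)))ᴴ *ᵥ theta M ψS ω n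

/-- Expectation of a random vector. -/
def expVec [MeasurableSpace Ω] (p : Measure Ω) (f : Ω → Fin d → ℂ) : Fin d → ℂ :=
  fun i => ∫ ω, f ω i ∂p

/-- Expectation of a random matrix. -/
def expMat [MeasurableSpace Ω] (p : Measure Ω) (A : Ω → Matrix (Fin d) (Fin d) ℂ) :
    Matrix (Fin d) (Fin d) ℂ :=
  Matrix.of fun i j => ∫ ω, A ω i j ∂p

end

end RandomProduct

/-! ### Contractions of a finite-dimensional norm and the mean ergodic theorem -/

namespace RandomProduct

variable {d : ℕ} {N : Seminorm ℂ (Fin d → ℂ)} {ψS : Fin d → ℂ} {A B : Matrix (Fin d) (Fin d) ℂ}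

/-! Write `T` for `expMat p M`. Two facts carry the theorem: `T` is ergodic, and `θ` is driven by
`Tᴴ` up to bounded orthogonal noise.

Ergodicity (`expMat_mem_ergodicSet`): let `q` be the quotient seminorm of `N` modulo `ψS`. Every
reduced dynamics operator contracts `q`, and the powers of an ergodic one send `q` to `0`. The law
of `M` charges every neighbourhood of some ergodic `A`, so `T = c B + (1 - c) C` with `c > 0` and
`B` close to `A`. If `T x = z x` with `|z| = 1` and `q x ≠ 0`, then a power `k` with `q (A ^ k x) <
q x` gives `q x = q (T ^ k x) < q x`. So `x` is a multiple of `ψS`.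

Convergence: `θ (n + 1) - Tᴴ θ n` has mean zero given the past, so a strong law for orthogonal
bounded variables makes its averages vanish. Hence the Cesàro means `m` of `θ` satisfy `m - Tᴴ m →
0`. Since `⟨ψS, m⟩ = 1` and the mean of `M_Q` is `T - |ψS⟩⟨𝔼ψ|`, this says `(1 - 𝔼[M_Q]ᴴ) m → 𝔼ψ`,
and the matrix is invertible because `1` is a simple eigenvalue of `T`. -/

theorem exists_seminorm_le_mul_norm (N : Seminorm ℂ (Fin d → ℂ)) :
    ∃ K : ℝ, 0 ≤ K ∧ ∀ x, N x ≤ K * ‖x‖ := by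
  refine ⟨∑ i, N (Pi.single i 1), Finset.sum_nonneg fun i _ => apply_nonneg N _, fun x => ?_⟩
  have hx : x = ∑ i, x i • (Pi.single i 1 : Fin d → ℂ) := by
    ext j; simp [Finset.sum_apply, Pi.single_apply]
  calc N x = N (∑ i, x i • (Pi.single i 1 : Fin d → ℂ)) := by rw [← hx]
    _ ≤ ∑ i, N (x i • (Pi.single i 1 : Fin d → ℂ)) :=
        Finset.le_sum_of_subadditive N (map_zero N).le (map_add_le_add N) _ _
    _ ≤ ∑ i, N (Pi.single i 1) * ‖x‖ := by
        refine Finset.sum_le_sum fun i _ => ?_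
        rw [map_smul_eq_mul, mul_comm]
        exact mul_le_mul_of_nonneg_left (norm_le_pi_norm x i) (apply_nonneg N _)
    _ = _ := by rw [Finset.sum_mul]

theorem continuous_seminorm (N : Seminorm ℂ (Fin d → ℂ)) : Continuous N := by
  obtain ⟨K, hK, hN⟩ := exists_seminorm_le_mul_norm N
  refine (LipschitzWith.of_le_add_mul ⟨K, hK⟩ fun x y => ?_).continuous
  have h1 : N x ≤ N y + N (x - y) := by simpa using map_add_le_add N y (x - y)
  rw [dist_eq_norm]
  exact h1.trans (add_le_add le_rfl (hN _))

theorem exists_norm_le_mul_seminorm (hN : ∀ x, N x = 0 → x = 0) :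
    ∃ K : ℝ, 0 ≤ K ∧ ∀ x, ‖x‖ ≤ K * N x := by
  rcases (Metric.sphere (0 : Fin d → ℂ) 1).eq_empty_or_nonempty with he | hne
  -- The unit sphere is empty exactly when `d = 0`.
  · refine ⟨0, le_rfl, fun x => ?_⟩
    have : x = 0 := by
      by_contra hx
      have : ((‖x‖⁻¹ : ℝ) : ℂ) • x ∈ Metric.sphere (0 : Fin d → ℂ) 1 := by
        simp [norm_smul, norm_ne_zero_iff.mpr hx]
      simp [he] at this
    simp [this]
  · obtain ⟨y, hy, hmin⟩ := (isCompact_sphere (0 : Fin d → ℂ) 1).exists_isMinOn hne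
      (continuous_seminorm N).continuousOn
    have hy1 : ‖y‖ = 1 := by simpa using hy
    have hpos : 0 < N y := by
      refine lt_of_le_of_ne (apply_nonneg N y) fun h => ?_
      simp [hN y h.symm] at hy1
    refine ⟨(N y)⁻¹, by positivity, fun x => ?_⟩
    rcases eq_or_ne x 0 with rfl | hx
    · simp
    have hx' : 0 < ‖x‖ := norm_pos_iff.mpr hx
    have hs : ((‖x‖⁻¹ : ℝ) : ℂ) • x ∈ Metric.sphere (0 : Fin d → ℂ) 1 := by
      simp [norm_smul, hx'.ne']
    have h2 : N y ≤ N (((‖x‖⁻¹ : ℝ) : ℂ) • x) := hmin hs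
    rw [map_smul_eq_mul, Complex.norm_real, norm_inv, norm_norm] at h2
    rw [inv_mul_eq_div, le_div_iff₀ hpos]
    rw [inv_mul_eq_div, le_div_iff₀ hx'] at h2
    linarith

theorem tendsto_zero_of_seminorm (hN : ∀ x, N x = 0 → x = 0) {u : ℕ → Fin d → ℂ}
    (hu : Tendsto (fun n => N (u n)) atTop (𝓝 0)) : Tendsto u atTop (𝓝 0) := by
  obtain ⟨K, -, hK⟩ := exists_norm_le_mul_seminorm hN
  refine squeeze_zero_norm (fun n => hK (u n)) ?_
  simpa using hu.const_mul K

namespace IsRDO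

theorem one : IsRDO N ψS (1 : Matrix (Fin d) (Fin d) ℂ) := ⟨fun x => by simp, by simp⟩

theorem mul (hA : IsRDO N ψS A) (hB : IsRDO N ψS B) : IsRDO N ψS (A * B) :=
  ⟨fun x => by rw [← mulVec_mulVec]; exact (hA.contraction _).trans (hB.contraction x),
   by rw [← mulVec_mulVec, hB.invariant, hA.invariant]⟩

theorem pow (hA : IsRDO N ψS A) (n : ℕ) : IsRDO N ψS (A ^ n) := by
  induction n with
  | zero => simpa using one
  | succ n ih => rw [pow_succ]; exact ih.mul hA

theorem exists_norm_entry_le (hN : ∀ x, N x = 0 → x = 0) :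
    ∃ K : ℝ, 0 ≤ K ∧ ∀ (A : Matrix (Fin d) (Fin d) ℂ) (φ : Fin d → ℂ), IsRDO N φ A →
      ∀ i j, ‖A i j‖ ≤ K := by
  obtain ⟨K, hK0, hK⟩ := exists_norm_le_mul_seminorm hN
  refine ⟨K * ∑ j, N (Pi.single j 1),
    mul_nonneg hK0 (Finset.sum_nonneg fun i _ => apply_nonneg N _), fun A φ hA i j => ?_⟩
  have h1 : A i j = (A *ᵥ Pi.single j 1) i := by simp
  rw [h1]
  calc ‖(A *ᵥ Pi.single j 1) i‖ ≤ ‖A *ᵥ Pi.single j 1‖ := norm_le_pi_norm _ i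
    _ ≤ K * N (A *ᵥ Pi.single j 1) := hK _
    _ ≤ K * N (Pi.single j 1) := mul_le_mul_of_nonneg_left (hA.contraction _) hK0
    _ ≤ _ := mul_le_mul_of_nonneg_left
        (Finset.single_le_sum (f := fun j => N (Pi.single j 1))
          (fun i _ => apply_nonneg N _) (Finset.mem_univ j)) hK0

/-- The eigenvalue `1` of a contraction is semisimple. -/
theorem eq_zero_of_mulVec_eq_add (hA : IsRDO N ψS A) (hN : ∀ x, N x = 0 → x = 0)
    {x y : Fin d → ℂ} (hx : A *ᵥ x = x + y) (hy : A *ᵥ y = y) : y = 0 := by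
  have hpow : ∀ n : ℕ, (A ^ n) *ᵥ x = x + (n : ℂ) • y := by
    intro n
    induction n with
    | zero => simp
    | succ n ih =>
      rw [pow_succ', ← mulVec_mulVec, ih, mulVec_add, mulVec_smul, hx, hy]
      push_cast
      rw [add_smul, one_smul]; abel
  -- A Jordan block would make the orbit of `x` grow linearly, but contraction bounds it by `N x`.
  have hle : ∀ n : ℕ, n * N y ≤ N x + N x := by
    intro n
    have h1 : (n : ℂ) • y = (A ^ n) *ᵥ x - x := by rw [hpow]; abel
    have h2 : N ((n : ℂ) • y) = n * N y := by rw [map_smul_eq_mul]; simp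
    rw [← h2, h1]
    exact (map_sub_le_add N _ _).trans (add_le_add ((hA.pow n).contraction x) le_rfl)
  refine hN y (le_antisymm ?_ (apply_nonneg N y))
  by_contra! h
  obtain ⟨n, hn⟩ := exists_nat_gt ((N x + N x) / N y)
  rw [div_lt_iff₀ h] at hn
  exact absurd (hle n) (not_le.mpr hn)

theorem mem_maxGenEigenspace_one_iff (hA : IsRDO N ψS A) (hN : ∀ x, N x = 0 → x = 0)
    {x : Fin d → ℂ} : x ∈ Module.End.maxGenEigenspace (toLin' A) 1 ↔ A *ᵥ x = x := by
  rw [Module.End.mem_maxGenEigenspace]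
  constructor
  · rintro ⟨k, hk⟩
    suffices ∀ (k : ℕ) (x : Fin d → ℂ),
        ((toLin' A - (1 : ℂ) • 1 : Module.End ℂ (Fin d → ℂ)) ^ k) x = 0 → A *ᵥ x = x from
      this k x hk
    clear hk x k
    intro k
    induction k with
    | zero =>
      intro x hx
      have : x = 0 := by simpa using hx
      simp [this]
    | succ k ih =>
      intro x hx
      rw [pow_succ, Module.End.mul_apply] at hx
      have h1 := ih _ hx
      have h2 : (toLin' A - (1 : ℂ) • 1) x = A *ᵥ x - x := by simp
      rw [h2] at h1
      have := hA.eq_zero_of_mulVec_eq_add hN (x := x) (by abel) h1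
      exact sub_eq_zero.mp this
  · intro h
    exact ⟨1, by simp [h]⟩

end IsRDO

/-- `A - 1` is onto on each generalized eigenspace with `ν ≠ 1`, by induction from `(ν - 1) x = (A -
1) x - (A - ν) x`. Vectors of the form `A y - y` have telescoping Cesàro means. -/
theorem exists_eq_mulVec_sub_of_mem_iSup {x : Fin d → ℂ}
    (hx : x ∈ ⨆ ν, ⨆ _ : ν ≠ (1 : ℂ), Module.End.maxGenEigenspace (toLin' A) ν) :
    ∃ y, x = A *ᵥ y - y := by
  suffices h : (⨆ ν, ⨆ _ : ν ≠ (1 : ℂ), Module.End.maxGenEigenspace (toLin' A) ν) ≤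
      LinearMap.range (toLin' A - 1) by
    obtain ⟨y, hy⟩ := h hx
    exact ⟨y, by simpa using hy.symm⟩
  refine iSup₂_le fun ν hν x hx => ?_
  rw [Module.End.mem_maxGenEigenspace] at hx
  obtain ⟨k, hk⟩ := hx
  induction k generalizing x with
  | zero => have : x = 0 := by simpa using hk
            rw [this]; exact zero_mem _
  | succ k ih =>
    rw [pow_succ, Module.End.mul_apply] at hk
    have h1 := ih _ hk
    have h2 : x = (ν - 1)⁻¹ • ((toLin' A - 1) x - (toLin' A - ν • 1) x) := by
      have : (toLin' A - 1) x - (toLin' A - ν • 1) x = (ν - 1) • x := by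
        simp [sub_smul]
      rw [this, smul_smul, inv_mul_cancel₀ (sub_ne_zero.mpr hν), one_smul]
    rw [h2]
    exact Submodule.smul_mem _ _ (Submodule.sub_mem _ (LinearMap.mem_range_self _ _) h1)

theorem spectralProj_mulVec (A : Matrix (Fin d) (Fin d) ℂ) (μ : ℂ) (x : Fin d → ℂ) :
    spectralProj A μ *ᵥ x =
      Submodule.projection _ _ (isCompl_maxGenEigenspace (toLin' A) μ) x := by
  rw [spectralProj, LinearMap.toMatrix'_mulVec]

namespace IsRDO

theorem tendsto_mean_mulVec_sub (hA : IsRDO N ψS A) (hN : ∀ x, N x = 0 → x = 0)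
    (y : Fin d → ℂ) :
    Tendsto (fun n : ℕ => (n : ℂ)⁻¹ • ∑ k ∈ Finset.range n, (A ^ k) *ᵥ (A *ᵥ y - y)) atTop
      (𝓝 0) := by
  refine tendsto_zero_of_seminorm hN ?_
  have hsum : ∀ n : ℕ, ∑ k ∈ Finset.range n, (A ^ k) *ᵥ (A *ᵥ y - y) = (A ^ n) *ᵥ y - y := by
    intro n
    have := Finset.sum_range_sub (fun k => (A ^ k) *ᵥ y) n
    simp only [pow_zero, one_mulVec] at this
    rw [← this]
    refine Finset.sum_congr rfl fun k _ => ?_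
    rw [mulVec_sub, mulVec_mulVec, pow_succ]
  refine squeeze_zero (fun n => apply_nonneg N _) (fun n => ?_)
    (tendsto_const_div_atTop_nhds_zero_nat (N y + N y))
  rw [hsum, map_smul_eq_mul, norm_inv, Complex.norm_natCast, inv_mul_eq_div]
  gcongr
  exact (map_sub_le_add N _ _).trans (add_le_add ((hA.pow n).contraction y) le_rfl)

/-- The mean ergodic theorem: the Cesàro means of the powers of a contraction converge to the
spectral projection for the eigenvalue `1`. -/
theorem tendsto_mean (hA : IsRDO N ψS A) (hN : ∀ x, N x = 0 → x = 0) (x : Fin d → ℂ) :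
    Tendsto (fun n : ℕ => (n : ℂ)⁻¹ • ∑ k ∈ Finset.range n, (A ^ k) *ᵥ x) atTop
      (𝓝 (spectralProj A 1 *ᵥ x)) := by
  have hc := isCompl_maxGenEigenspace (toLin' A) 1
  obtain ⟨y, hy⟩ := exists_eq_mulVec_sub_of_mem_iSup (Submodule.sub_projection_mem hc x)
  have hP := (hA.mem_maxGenEigenspace_one_iff hN).mp (Submodule.projection_apply_mem hc x)
  rw [← spectralProj_mulVec] at hP hy
  have hpow : ∀ k : ℕ, (A ^ k) *ᵥ (spectralProj A 1 *ᵥ x) = spectralProj A 1 *ᵥ x := by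
    intro k
    induction k with
    | zero => simp
    | succ k ih => rw [pow_succ, ← mulVec_mulVec, hP, ih]
  have h := (hA.tendsto_mean_mulVec_sub hN y).add_const (spectralProj A 1 *ᵥ x)
  rw [zero_add] at h
  refine h.congr' ?_
  filter_upwards [eventually_ne_atTop 0] with n hn
  have hn' : (n : ℂ) ≠ 0 := by exact_mod_cast hn
  rw [← hy]
  simp only [mulVec_sub, hpow, Finset.sum_sub_distrib, Finset.sum_const, Finset.card_range,
    smul_sub]
  rw [← Nat.cast_smul_eq_nsmul ℂ, smul_smul, inv_mul_cancel₀ hn', one_smul]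
  abel

theorem spectralProj_mulVec_mulVec (hA : IsRDO N ψS A) (hN : ∀ x, N x = 0 → x = 0)
    (x : Fin d → ℂ) : spectralProj A 1 *ᵥ (A *ᵥ x) = spectralProj A 1 *ᵥ x := by
  have := tendsto_nhds_unique (hA.tendsto_mean hN (A *ᵥ x - x)) (hA.tendsto_mean_mulVec_sub hN x)
  rwa [mulVec_sub, sub_eq_zero] at this

theorem spectralProj_mulVec_of_fixed (hA : IsRDO N ψS A) (hN : ∀ x, N x = 0 → x = 0)
    {x : Fin d → ℂ} (hx : A *ᵥ x = x) : spectralProj A 1 *ᵥ x = x := by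
  rw [spectralProj_mulVec]
  exact Submodule.projection_apply_of_mem_left _ ((hA.mem_maxGenEigenspace_one_iff hN).mpr hx)

/-- Contractivity survives the Cesàro limit. This is the source of the bounds on `psi` uniform in
the matrix. -/
theorem spectralProj (hA : IsRDO N ψS A) (hN : ∀ x, N x = 0 → x = 0) :
    IsRDO N ψS (spectralProj A 1) := by
  refine ⟨fun x => ?_, hA.spectralProj_mulVec_of_fixed hN hA.invariant⟩
  refine le_of_tendsto (((continuous_seminorm N).tendsto _).comp (hA.tendsto_mean hN x)) ?_
  filter_upwards [eventually_gt_atTop 0] with n hn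
  have hn' : (0 : ℝ) < n := by exact_mod_cast hn
  simp only [Function.comp]
  rw [map_smul_eq_mul, norm_inv, Complex.norm_natCast, inv_mul_le_iff₀ hn']
  calc N (∑ k ∈ Finset.range n, (A ^ k) *ᵥ x) ≤ ∑ k ∈ Finset.range n, N ((A ^ k) *ᵥ x) :=
        Finset.le_sum_of_subadditive N (map_zero N).le (map_add_le_add N) _ _
    _ ≤ ∑ k ∈ Finset.range n, N x := Finset.sum_le_sum fun k _ => (hA.pow k).contraction x
    _ = n * N x := by simp

end IsRDO

end RandomProduct

/-! ### The quotient seminorm modulo `ψS` and a criterion for ergodicity -/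

namespace RandomProduct

variable {d : ℕ} {N : Seminorm ℂ (Fin d → ℂ)} {ψS : Fin d → ℂ} {A B C : Matrix (Fin d) (Fin d) ℂ}

/-- The largest seminorm below `N` that vanishes at `ψ`: the quotient norm modulo `ℂ ψ`. -/
noncomputable def transverseSeminorm (N : Seminorm ℂ (Fin d → ℂ)) (ψ : Fin d → ℂ) :
    Seminorm ℂ (Fin d → ℂ) :=
  sSup {p | p ≤ N ∧ p ψ = 0}

theorem bddAbove_transverse (N : Seminorm ℂ (Fin d → ℂ)) (ψ : Fin d → ℂ) :
    BddAbove {p : Seminorm ℂ (Fin d → ℂ) | p ≤ N ∧ p ψ = 0} :=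
  ⟨N, fun _ hp => hp.1⟩

theorem le_transverseSeminorm {p : Seminorm ℂ (Fin d → ℂ)} (h : p ≤ N) (h0 : p ψS = 0) :
    p ≤ transverseSeminorm N ψS :=
  le_csSup (bddAbove_transverse N ψS) (show p ∈ {p | p ≤ N ∧ p ψS = 0} from ⟨h, h0⟩)

theorem transverseSeminorm_self : transverseSeminorm N ψS ψS = 0 := by
  rw [transverseSeminorm, Seminorm.sSup_apply (bddAbove_transverse N ψS)]
  refine le_antisymm (Real.iSup_le (fun p => p.2.2.le) le_rfl) (Real.iSup_nonneg fun p => ?_)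
  exact apply_nonneg p.1 _

theorem transverseSeminorm_mulVec_le (hA : IsRDO N ψS A) (x : Fin d → ℂ) :
    transverseSeminorm N ψS (A *ᵥ x) ≤ transverseSeminorm N ψS x := by
  conv_lhs => rw [transverseSeminorm, Seminorm.sSup_apply (bddAbove_transverse N ψS)]
  refine Real.iSup_le (fun p => ?_) (apply_nonneg _ _)
  -- Composing a competitor in the supremum with `A` gives another competitor.
  refine le_transverseSeminorm (p := p.1.comp (toLin' A)) (fun y => ?_) ?_ x
  · exact (p.2.1 _).trans (by simpa using hA.contraction y)
  · simpa [hA.invariant] using p.2.2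

theorem mem_span_of_transverseSeminorm_eq_zero (hN : ∀ x, N x = 0 → x = 0) {x : Fin d → ℂ}
    (hx : transverseSeminorm N ψS x = 0) : x ∈ Submodule.span ℂ {ψS} := by
  by_contra hmem
  obtain ⟨ℓ, hℓx, hℓ⟩ := Submodule.exists_le_ker_of_notMem hmem
  have hℓψ : ℓ ψS = 0 := hℓ (Submodule.mem_span_singleton_self ψS)
  obtain ⟨K, hK0, hK⟩ := exists_seminorm_le_mul_norm ((normSeminorm ℂ ℂ).comp ℓ)
  obtain ⟨L, hL0, hL⟩ := exists_norm_le_mul_seminorm hN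
  have hKL : 0 < K * L + 1 := by positivity
  -- A functional that kills `ψS` but not `x`, scaled to lie below `N`; the `+ 1` only keeps the
  -- factor invertible.
  let p : Seminorm ℂ (Fin d → ℂ) :=
    (normSeminorm ℂ ℂ).comp ((((K * L + 1)⁻¹ : ℝ) : ℂ) • ℓ)
  have hp : ∀ y, p y = (K * L + 1)⁻¹ * ‖ℓ y‖ := fun y => by
    change ‖(((K * L + 1)⁻¹ : ℝ) : ℂ) • ℓ y‖ = _
    rw [norm_smul, Complex.norm_real, Real.norm_of_nonneg (by positivity)]
  have hle : p ≤ transverseSeminorm N ψS := by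
    refine le_transverseSeminorm (fun y => ?_) (by rw [hp, hℓψ]; simp)
    change p y ≤ N y
    rw [hp, inv_mul_le_iff₀ hKL]
    have h1 : ‖ℓ y‖ ≤ K * ‖y‖ := hK y
    have h2 := mul_le_mul_of_nonneg_left (hL y) hK0
    nlinarith [apply_nonneg N y]
  have h1 : p x ≤ 0 := hx ▸ hle x
  rw [hp] at h1
  have : 0 < (K * L + 1)⁻¹ * ‖ℓ x‖ := mul_pos (by positivity) (norm_pos_iff.mpr hℓx)
  linarith

theorem hasEigenvector_toLin' {z : ℂ} {x : Fin d → ℂ} (hx0 : x ≠ 0) (hx : A *ᵥ x = z • x) :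
    Module.End.HasEigenvector (toLin' A) z x :=
  Module.End.hasEigenvector_iff.mpr ⟨Module.End.mem_eigenspace_iff.mpr (by simpa using hx), hx0⟩

theorem mem_spectrum_iff_exists_mulVec {z : ℂ} :
    z ∈ spectrum ℂ A ↔ ∃ x, x ≠ 0 ∧ A *ᵥ x = z • x := by
  rw [← spectrum_toLin', ← Module.End.hasEigenvalue_iff_mem_spectrum]
  constructor
  · intro h
    obtain ⟨x, hx⟩ := h.exists_hasEigenvector
    exact ⟨x, hx.2, by simpa using hx.apply_eq_smul⟩
  · rintro ⟨x, hx0, hx⟩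
    exact Module.End.hasEigenvalue_of_hasEigenvector (hasEigenvector_toLin' hx0 hx)

theorem finrank_maxGenEigenspace_toLin' (A : Matrix (Fin d) (Fin d) ℂ) (z : ℂ) :
    Module.finrank ℂ (Module.End.maxGenEigenspace (toLin' A) z) =
      A.charpoly.rootMultiplicity z := by
  rw [LinearMap.finrank_maxGenEigenspace_eq, charpoly_toLin']

theorem maxGenEigenspace_one_eq_span (hψ : ψS ≠ 0) (hN : ∀ x, N x = 0 → x = 0)
    (hA : A ∈ ergodicSet N ψS) :
    Module.End.maxGenEigenspace (toLin' A) 1 = Submodule.span ℂ {ψS} := by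
  symm
  refine Submodule.eq_of_le_of_finrank_eq ?_ ?_
  · rw [Submodule.span_singleton_le_iff_mem, hA.1.mem_maxGenEigenspace_one_iff hN]
    exact hA.1.invariant
  · rw [finrank_span_singleton hψ, finrank_maxGenEigenspace_toLin', hA.2.1]

theorem tendsto_transverseSeminorm_of_mem_maxGenEigenspace (hψ : ψS ≠ 0)
    (hN : ∀ x, N x = 0 → x = 0) (hA : A ∈ ergodicSet N ψS) (ν : ℂ) {x : Fin d → ℂ}
    (hx : x ∈ Module.End.maxGenEigenspace (toLin' A) ν) :
    Tendsto (fun n => transverseSeminorm N ψS ((A ^ n) *ᵥ x)) atTop (𝓝 0) := by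
  rcases eq_or_ne ν 1 with rfl | hν
  · rw [maxGenEigenspace_one_eq_span hψ hN hA, Submodule.mem_span_singleton] at hx
    obtain ⟨c, rfl⟩ := hx
    simp only [mulVec_smul, (hA.1.pow _).invariant, map_smul_eq_mul, transverseSeminorm_self,
      mul_zero]
    exact tendsto_const_nhds
  rw [Module.End.mem_maxGenEigenspace] at hx
  obtain ⟨k, hk⟩ := hx
  induction k generalizing x with
  | zero => have : x = 0 := by simpa using hk
            simp [this]
  | succ k ih =>
    rw [pow_succ, Module.End.mul_apply] at hk
    set y := (toLin' A - ν • 1 : Module.End ℂ (Fin d → ℂ)) x with hy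
    have hb := ih hk
    have hAx : A *ᵥ x = ν • x + y := by simp [hy]
    -- For `‖ν‖ < 1` the decreasing sequence has a limit `L` with `L ≤ ‖ν‖ L`, since the
    -- contribution of `y` vanishes by induction. Otherwise `ν ≠ 1` is not an eigenvalue and the
    -- generalized eigenspace is trivial.
    by_cases hlt : ‖ν‖ < 1
    · set a : ℕ → ℝ := fun n => transverseSeminorm N ψS ((A ^ n) *ᵥ x) with ha
      have hanti : Antitone a := antitone_nat_of_succ_le fun n => by
        simp only [ha]
        rw [pow_succ', ← mulVec_mulVec]
        exact transverseSeminorm_mulVec_le hA.1 _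
      have hlim := tendsto_atTop_ciInf hanti
        ⟨0, by rintro _ ⟨n, rfl⟩; exact apply_nonneg _ _⟩
      set L := ⨅ n, a n
      have hL0 : 0 ≤ L := ge_of_tendsto' hlim fun n => apply_nonneg _ _
      have hle : L ≤ ‖ν‖ * L + 0 := by
        refine le_of_tendsto_of_tendsto' ((tendsto_add_atTop_iff_nat 1).mpr hlim)
          ((hlim.const_mul ‖ν‖).add hb) fun n => ?_
        simp only [ha]
        rw [pow_succ, ← mulVec_mulVec, hAx, mulVec_add, mulVec_smul]
        refine (map_add_le_add _ _ _).trans ?_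
        rw [map_smul_eq_mul]
      have hL : L = 0 := by nlinarith
      rwa [hL] at hlim
    · have hinj : ∀ y : Fin d → ℂ, (toLin' A - ν • 1 : Module.End ℂ (Fin d → ℂ)) y = 0 → y = 0 := by
        intro y hy
        by_contra hy0
        have hev : A *ᵥ y = ν • y := by simpa [sub_eq_zero] using hy
        have h1 := hA.1.contraction y
        rw [hev, map_smul_eq_mul] at h1
        have hpos : 0 < N y := lt_of_le_of_ne (apply_nonneg N y) fun h => hy0 (hN y h.symm)
        have h2 : ‖ν‖ ≤ 1 := le_of_mul_le_mul_right (by simpa using h1) hpos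
        exact hν (hA.2.2 ν (mem_spectrum_iff_exists_mulVec.mpr ⟨y, hy0, hev⟩)
          (le_antisymm h2 (not_lt.mp hlt)))
      have hy0 : y = 0 := by
        clear_value y
        clear hb hAx hy ih
        induction k with
        | zero => simpa using hk
        | succ k ih2 =>
          rw [pow_succ', Module.End.mul_apply] at hk
          exact ih2 (hinj _ hk)
      simp [hinj x hy0]

theorem tendsto_transverseSeminorm_pow (hψ : ψS ≠ 0)
    (hN : ∀ x, N x = 0 → x = 0) (hA : A ∈ ergodicSet N ψS) (x : Fin d → ℂ) :
    Tendsto (fun n => transverseSeminorm N ψS ((A ^ n) *ᵥ x)) atTop (𝓝 0) := by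
  have hx : x ∈ ⨆ ν, Module.End.maxGenEigenspace (toLin' A) ν := by
    rw [Module.End.iSup_maxGenEigenspace_eq_top]; trivial
  refine Submodule.iSup_induction _
    (motive := fun x => Tendsto (fun n => transverseSeminorm N ψS ((A ^ n) *ᵥ x)) atTop (𝓝 0))
    hx (fun ν y hy => tendsto_transverseSeminorm_of_mem_maxGenEigenspace hψ hN hA ν hy)
    (by simp) fun y z hy hz => ?_
  refine squeeze_zero (fun n => apply_nonneg _ _) (fun n => ?_) (by simpa using hy.add hz)
  rw [mulVec_add]
  exact map_add_le_add _ _ _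

/-- Semisimplicity of the eigenvalue `1` turns a statement about eigenvectors into one about
algebraic multiplicity. -/
theorem mem_ergodicSet_of_forall_mem_span (hA : IsRDO N ψS A) (hψ : ψS ≠ 0)
    (hN : ∀ x, N x = 0 → x = 0)
    (h : ∀ (z : ℂ) (x : Fin d → ℂ), ‖z‖ = 1 → A *ᵥ x = z • x → x ∈ Submodule.span ℂ {ψS}) :
    A ∈ ergodicSet N ψS := by
  refine ⟨hA, ?_, fun z hz hz1 => ?_⟩
  · have : Module.End.maxGenEigenspace (toLin' A) 1 = Submodule.span ℂ {ψS} := by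
      refine le_antisymm (fun x hx => ?_) ?_
      · exact h 1 x (by simp) (by simpa using (hA.mem_maxGenEigenspace_one_iff hN).mp hx)
      · rw [Submodule.span_singleton_le_iff_mem, hA.mem_maxGenEigenspace_one_iff hN]
        exact hA.invariant
    rw [← finrank_maxGenEigenspace_toLin', this, finrank_span_singleton hψ]
  · obtain ⟨x, hx0, hx⟩ := mem_spectrum_iff_exists_mulVec.mp hz
    obtain ⟨c, rfl⟩ := Submodule.mem_span_singleton.mp (h z x hz1 hx)
    rw [mulVec_smul, hA.invariant] at hx
    have h2 : (z - 1) • (c • ψS) = 0 := by rw [sub_smul, ← hx, one_smul, sub_self]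
    exact sub_eq_zero.mp ((smul_eq_zero.mp h2).resolve_right hx0)

/-- A convex combination contracts a vector along the powers at least in proportion to the weight of
one of its terms. -/
theorem transverseSeminorm_pow_convexCombo_le (hA : IsRDO N ψS A) (hB : IsRDO N ψS B)
    (hC : IsRDO N ψS C) {c : ℝ} (hc0 : 0 ≤ c) (hc1 : c ≤ 1)
    (h : A = (c : ℂ) • B + ((1 - c : ℝ) : ℂ) • C) (k : ℕ) (x : Fin d → ℂ) :
    transverseSeminorm N ψS ((A ^ k) *ᵥ x) ≤
      c ^ k * transverseSeminorm N ψS ((B ^ k) *ᵥ x) +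
        (1 - c ^ k) * transverseSeminorm N ψS x := by
  induction k generalizing x with
  | zero => simp
  | succ k ih =>
    have hAx : A *ᵥ x = (c : ℂ) • (B *ᵥ x) + ((1 - c : ℝ) : ℂ) • (C *ᵥ x) := by
      rw [h, add_mulVec, smul_mulVec, smul_mulVec]
    -- Only the path applying `B` at every step is tracked; all other paths, of total weight `1 - c
    -- ^ k`, are bounded by contraction.
    have h1 := ih (B *ᵥ x)
    have h2 := transverseSeminorm_mulVec_le hB x
    have h3 := (transverseSeminorm_mulVec_le (hA.pow k) (C *ᵥ x)).trans
      (transverseSeminorm_mulVec_le hC x)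
    have hck : c ^ k ≤ 1 := pow_le_one₀ hc0 hc1
    rw [pow_succ A, ← mulVec_mulVec, hAx, mulVec_add, mulVec_smul, mulVec_smul]
    refine (map_add_le_add _ _ _).trans ?_
    rw [map_smul_eq_mul, map_smul_eq_mul, Complex.norm_real, Complex.norm_real,
      Real.norm_of_nonneg hc0, Real.norm_of_nonneg (sub_nonneg.mpr hc1)]
    rw [mulVec_mulVec _ (B ^ k), ← pow_succ] at h1
    have h4 := mul_le_mul_of_nonneg_left h1 hc0
    have h5 := mul_le_mul_of_nonneg_left h3 (sub_nonneg.mpr hc1)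
    have h6 := mul_le_mul_of_nonneg_left h2 (mul_nonneg hc0 (sub_nonneg.mpr hck))
    rw [pow_succ c]
    nlinarith

end RandomProduct

/-! ### Algebra of `psi`, `partQ` and the rank-one spectral projection -/

namespace RandomProduct

variable {d : ℕ} {N : Seminorm ℂ (Fin d → ℂ)} {ψS : Fin d → ℂ} {A : Matrix (Fin d) (Fin d) ℂ}

theorem ketBra_mulVec (u v x : Fin d → ℂ) : ketBra u v *ᵥ x = (star v ⬝ᵥ x) • u := by
  rw [ketBra, vecMulVec_mulVec, op_smul_eq_smul]

theorem conjTranspose_ketBra (u v : Fin d → ℂ) : (ketBra u v)ᴴ = ketBra v u := by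
  rw [ketBra, conjTranspose_vecMulVec, star_star, ketBra]

theorem star_conjTranspose_mulVec_dotProduct (A : Matrix (Fin d) (Fin d) ℂ) (v x : Fin d → ℂ) :
    star (Aᴴ *ᵥ v) ⬝ᵥ x = star v ⬝ᵥ A *ᵥ x := by
  rw [star_mulVec, conjTranspose_conjTranspose, dotProduct_mulVec]

theorem star_psi_dotProduct (ψS : Fin d → ℂ) (A : Matrix (Fin d) (Fin d) ℂ) (x : Fin d → ℂ) :
    star (psi ψS A) ⬝ᵥ x = star ψS ⬝ᵥ spectralProj A 1 *ᵥ x :=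
  star_conjTranspose_mulVec_dotProduct _ _ _

theorem star_dotProduct_self_eq_one (h : ‖WithLp.toLp 2 ψS‖ = 1) : star ψS ⬝ᵥ ψS = 1 := by
  have h1 := inner_self_eq_norm_sq_to_K (𝕜 := ℂ) (WithLp.toLp 2 ψS)
  rw [h, EuclideanSpace.inner_eq_star_dotProduct] at h1
  rw [dotProduct_comm]
  simpa using h1

theorem star_psi_dotProduct_self (hA : IsRDO N ψS A) (hN : ∀ x, N x = 0 → x = 0)
    (h1 : star ψS ⬝ᵥ ψS = 1) : star (psi ψS A) ⬝ᵥ ψS = 1 := by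
  rw [star_psi_dotProduct, (hA.spectralProj hN).invariant, h1]

theorem star_dotProduct_eq_one_symm {u v : Fin d → ℂ} (h : star u ⬝ᵥ v = 1) :
    star v ⬝ᵥ u = 1 := by
  have := congrArg star h
  rwa [star_dotProduct, star_star, star_one] at this

theorem conjTranspose_mulVec_psi (hA : IsRDO N ψS A) (hN : ∀ x, N x = 0 → x = 0) :
    Aᴴ *ᵥ psi ψS A = psi ψS A := by
  have : spectralProj A 1 * A = spectralProj A 1 := ext_of_mulVec_single fun i => by
    rw [← mulVec_mulVec, hA.spectralProj_mulVec_mulVec hN]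
  rw [psi, mulVec_mulVec, ← conjTranspose_mul, this]

/-- `Aᴴ` fixes `psi`, `A` fixes `ψS`, and the two pair to `1`, so the cross terms of `Q A Q`
collapse. The result is linear in `A` and conjugate-linear in `psi`, so expectations pass through
it. -/
theorem partQ_eq (hA : IsRDO N ψS A) (hN : ∀ x, N x = 0 → x = 0) (h1 : star ψS ⬝ᵥ ψS = 1) :
    partQ ψS A = A - ketBra ψS (psi ψS A) := by
  have hψ := star_psi_dotProduct_self hA hN h1
  have hA2 : ∀ x, star (psi ψS A) ⬝ᵥ A *ᵥ x = star (psi ψS A) ⬝ᵥ x := fun x => by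
    rw [← star_conjTranspose_mulVec_dotProduct, conjTranspose_mulVec_psi hA hN]
  refine ext_of_mulVec_single fun i => ?_
  set x : Fin d → ℂ := Pi.single i 1
  rw [partQ, ← mulVec_mulVec, ← mulVec_mulVec]
  simp only [sub_mulVec, one_mulVec, ketBra_mulVec, mulVec_sub, mulVec_smul, hA.invariant,
    hA2, hψ, one_smul, sub_self, smul_zero, sub_zero]

theorem spectralProj_eq_ketBra (hA : A ∈ ergodicSet N ψS) (hN : ∀ x, N x = 0 → x = 0)
    (h1 : star ψS ⬝ᵥ ψS = 1) : spectralProj A 1 = ketBra ψS (psi ψS A) := by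
  have hψ : ψS ≠ 0 := by rintro rfl; simp at h1
  refine ext_of_mulVec_single fun i => ?_
  set x : Fin d → ℂ := Pi.single i 1
  have hmem := Submodule.projection_apply_mem (isCompl_maxGenEigenspace (toLin' A) 1) x
  rw [← spectralProj_mulVec, maxGenEigenspace_one_eq_span hψ hN hA,
    Submodule.mem_span_singleton] at hmem
  obtain ⟨c, hc⟩ := hmem
  rw [ketBra_mulVec, star_psi_dotProduct, ← hc, dotProduct_smul, h1, smul_eq_mul, mul_one]

theorem conjTranspose_spectralProj_mulVec (hA : A ∈ ergodicSet N ψS)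
    (hN : ∀ x, N x = 0 → x = 0) (h1 : star ψS ⬝ᵥ ψS = 1) {v : Fin d → ℂ}
    (hv : star ψS ⬝ᵥ v = 1) : (spectralProj A 1)ᴴ *ᵥ v = psi ψS A := by
  rw [spectralProj_eq_ketBra hA hN h1, conjTranspose_ketBra, ketBra_mulVec, hv, one_smul]

/-- Used with `φ` the fixed vector of `𝔼[M]ᴴ`, which identifies the limit, and with `φ` a Cesàro
mean of `θ`, which proves convergence. -/
theorem one_sub_conjTranspose_mulVec (A : Matrix (Fin d) (Fin d) ℂ) {φ : Fin d → ℂ}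
    (v : Fin d → ℂ) (hφ : star ψS ⬝ᵥ φ = 1) :
    (1 - (A - ketBra ψS v)ᴴ) *ᵥ φ = (φ - Aᴴ *ᵥ φ) + v := by
  rw [conjTranspose_sub, conjTranspose_ketBra, sub_mulVec, sub_mulVec, ketBra_mulVec, hφ,
    one_mulVec, one_smul]
  abel

/-- A kernel vector `x` of `1 - (A - |ψS⟩⟨v|)` satisfies `A x = x + ⟨v, x⟩ ψS`. Semisimplicity kills
the last term, simplicity gives `x = c ψS`, and `⟨v, ψS⟩ = 1` forces `x = 0`. -/
theorem isUnit_one_sub_conjTranspose (hA : A ∈ ergodicSet N ψS) (hN : ∀ x, N x = 0 → x = 0)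
    {v : Fin d → ℂ} (hv : star v ⬝ᵥ ψS = 1) : IsUnit (1 - (A - ketBra ψS v)ᴴ) := by
  have hψ : ψS ≠ 0 := by rintro rfl; simp at hv
  suffices h : IsUnit (1 - (A - ketBra ψS v)) by
    have := h.star
    rwa [star_eq_conjTranspose, conjTranspose_sub, conjTranspose_one] at this
  rw [← mulVec_injective_iff_isUnit]
  refine (injective_iff_map_eq_zero (mulVecLin (1 - (A - ketBra ψS v)))).mpr fun x hx => ?_
  rw [mulVecLin_apply, sub_mulVec, sub_mulVec, ketBra_mulVec, one_mulVec, sub_eq_zero] at hx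
  have hAx : A *ᵥ x = x + (star v ⬝ᵥ x) • ψS := by
    rw [eq_sub_iff_add_eq] at hx; exact hx.symm
  have h0 := hA.1.eq_zero_of_mulVec_eq_add hN hAx (by rw [mulVec_smul, hA.1.invariant])
  rw [h0, add_zero] at hAx
  have hmem := (hA.1.mem_maxGenEigenspace_one_iff hN).mpr hAx
  rw [maxGenEigenspace_one_eq_span hψ hN hA, Submodule.mem_span_singleton] at hmem
  obtain ⟨c, rfl⟩ := hmem
  rw [dotProduct_smul, hv, smul_eq_mul, mul_one] at h0
  exact h0

theorem star_psi_dotProduct_le (hN : ∀ x, N x = 0 → x = 0) (ψS : Fin d → ℂ) :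
    ∃ K : ℝ, 0 ≤ K ∧ ∀ A, IsRDO N ψS A → ∀ x, ‖star (psi ψS A) ⬝ᵥ x‖ ≤ K * N x := by
  obtain ⟨K, hK0, hK⟩ := exists_norm_le_mul_seminorm hN
  refine ⟨(∑ i, ‖ψS i‖) * K, by positivity, fun A hA x => ?_⟩
  rw [star_psi_dotProduct]
  set y := spectralProj A 1 *ᵥ x with hy
  have hyN : N y ≤ N x := (hA.spectralProj hN).contraction x
  calc ‖star ψS ⬝ᵥ y‖ ≤ ∑ i, ‖ψS i‖ * ‖y‖ := by
        refine norm_sum_le_of_le _ fun i _ => ?_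
        rw [norm_mul, Pi.star_apply, norm_star]
        exact mul_le_mul_of_nonneg_left (norm_le_pi_norm y i) (norm_nonneg _)
    _ = (∑ i, ‖ψS i‖) * ‖y‖ := by rw [Finset.sum_mul]
    _ ≤ (∑ i, ‖ψS i‖) * (K * N x) := by
        refine mul_le_mul_of_nonneg_left ((hK y).trans ?_) (by positivity)
        exact mul_le_mul_of_nonneg_left hyN hK0
    _ = _ := by ring

end RandomProduct

/-! ### Measurability, integrability, and ergodicity of the expectation -/

namespace RandomProduct

variable {d : ℕ} {Ω : Type*} [MeasurableSpace Ω] {p : Measure Ω}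
  {N : Seminorm ℂ (Fin d → ℂ)} {ψS : Fin d → ℂ} {M : Ω → Matrix (Fin d) (Fin d) ℂ}

theorem convex_setOf_isRDO (N : Seminorm ℂ (Fin d → ℂ)) (ψS : Fin d → ℂ) :
    Convex ℝ {A : Fin d → Fin d → ℂ | IsRDO N ψS (of A)} := by
  intro A hA B hB a b ha hb hab
  change IsRDO N ψS (a • of A + b • of B)
  refine ⟨fun x => ?_, ?_⟩
  · rw [add_mulVec, smul_mulVec, smul_mulVec, ← Complex.coe_smul, ← Complex.coe_smul]
    refine (map_add_le_add _ _ _).trans ?_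
    rw [map_smul_eq_mul, map_smul_eq_mul, Complex.norm_real, Complex.norm_real,
      Real.norm_of_nonneg ha, Real.norm_of_nonneg hb]
    have h1 := mul_le_mul_of_nonneg_left (hA.contraction x) ha
    have h2 := mul_le_mul_of_nonneg_left (hB.contraction x) hb
    calc _ ≤ a * N x + b * N x := add_le_add h1 h2
      _ = N x := by rw [← add_mul, hab, one_mul]
  · rw [add_mulVec, smul_mulVec, smul_mulVec, hA.invariant, hB.invariant, ← add_smul, hab,
      one_smul]

theorem isClosed_setOf_isRDO (N : Seminorm ℂ (Fin d → ℂ)) (ψS : Fin d → ℂ) :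
    IsClosed {A : Fin d → Fin d → ℂ | IsRDO N ψS (of A)} := by
  have hc : Continuous (of : (Fin d → Fin d → ℂ) → Matrix (Fin d) (Fin d) ℂ) := continuous_id
  have : {A : Fin d → Fin d → ℂ | IsRDO N ψS (of A)} =
      (⋂ x, {A : Fin d → Fin d → ℂ | N (of A *ᵥ x) ≤ N x}) ∩ {A | of A *ᵥ ψS = ψS} := by
    ext A
    simp only [Set.mem_ofPred_eq, Set.mem_inter_iff, Set.mem_iInter]
    exact ⟨fun h => ⟨h.1, h.2⟩, fun h => ⟨h.1, h.2⟩⟩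
  rw [this]
  refine (isClosed_iInter fun x => isClosed_le ?_ continuous_const).inter
    (isClosed_eq (by fun_prop) continuous_const)
  exact (continuous_seminorm N).comp (by fun_prop)

theorem measurable_entry_pow (hM : ∀ i j, Measurable fun ω => M ω i j) (n : ℕ) (i j : Fin d) :
    Measurable fun ω => ((M ω) ^ n) i j := by
  induction n generalizing i j with
  | zero => simp
  | succ n ih =>
    simp only [pow_succ, mul_apply]
    exact Finset.measurable_sum _ fun k _ => (ih i k).mul (hM k j)

/-- The mean ergodic theorem exhibits the projection as a pointwise limit of polynomials in `M ω`.
-/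
theorem measurable_spectralProj (hM : IsRRDO N ψS M) (i j : Fin d) :
    Measurable fun ω => spectralProj (M ω) 1 i j := by
  refine measurable_of_tendsto_metrizable (f := fun (n : ℕ) ω =>
    ((n : ℂ)⁻¹ • ∑ k ∈ Finset.range n, ((M ω) ^ k) *ᵥ (Pi.single j 1 : Fin d → ℂ)) i)
    (fun n => ?_) ?_
  · simp only [Pi.smul_apply, Finset.sum_apply, mulVec_single_one, col_apply]
    exact (Finset.measurable_sum _ fun k _ =>
      measurable_entry_pow hM.measurable k i j).const_smul (n : ℂ)⁻¹
  · rw [tendsto_pi_nhds]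
    intro ω
    have := ((hM.isRDO ω).tendsto_mean hM.isNorm (Pi.single j 1))
    rw [tendsto_pi_nhds] at this
    simpa using this i

theorem measurable_psi (hM : IsRRDO N ψS M) (i : Fin d) :
    Measurable fun ω => psi ψS (M ω) i := by
  simp only [psi, mulVec, dotProduct, conjTranspose_apply]
  refine Finset.measurable_sum _ fun j _ => ?_
  exact (continuous_star.measurable.comp (measurable_spectralProj hM j i)).mul_const _

theorem exists_norm_psi_le (hN : ∀ x, N x = 0 → x = 0) (ψS : Fin d → ℂ) :
    ∃ K : ℝ, 0 ≤ K ∧ ∀ A, IsRDO N ψS A → ∀ i, ‖psi ψS A i‖ ≤ K := by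
  obtain ⟨K, hK0, hK⟩ := star_psi_dotProduct_le hN ψS
  refine ⟨K * ∑ j, N (Pi.single j 1), by positivity, fun A hA i => ?_⟩
  have h := hK A hA (Pi.single i 1)
  rw [dotProduct_single_one, Pi.star_apply, norm_star] at h
  exact h.trans (mul_le_mul_of_nonneg_left
        (Finset.single_le_sum (f := fun j => N (Pi.single j 1))
          (fun i _ => apply_nonneg N _) (Finset.mem_univ i)) hK0)

theorem integrable_entry [IsFiniteMeasure p] (hM : IsRRDO N ψS M) (i j : Fin d) :
    Integrable (fun ω => M ω i j) p := by
  obtain ⟨K, -, hK⟩ := IsRDO.exists_norm_entry_le hM.isNorm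
  exact Integrable.of_bound (hM.measurable i j).aestronglyMeasurable K
    (ae_of_all _ fun ω => hK _ _ (hM.isRDO ω) i j)

theorem integrable_psi [IsFiniteMeasure p] (hM : IsRRDO N ψS M) (i : Fin d) :
    Integrable (fun ω => psi ψS (M ω) i) p := by
  obtain ⟨K, -, hK⟩ := exists_norm_psi_le hM.isNorm ψS
  exact Integrable.of_bound (measurable_psi hM i).aestronglyMeasurable K
    (ae_of_all _ fun ω => hK _ (hM.isRDO ω) i)

theorem partQ_entry (hM : IsRRDO N ψS M) (ω : Ω) (i j : Fin d) :
    partQ ψS (M ω) i j = M ω i j - ψS i * star (psi ψS (M ω) j) := by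
  rw [partQ_eq (hM.isRDO ω) hM.isNorm (star_dotProduct_self_eq_one hM.normalized)]
  simp [ketBra, vecMulVec_apply]

theorem integrable_star_psi [IsFiniteMeasure p] (hM : IsRRDO N ψS M) (j : Fin d) :
    Integrable (fun ω => star (psi ψS (M ω) j)) p := by
  obtain ⟨K, -, hK⟩ := exists_norm_psi_le hM.isNorm ψS
  exact Integrable.of_bound (continuous_star.measurable.comp
    (measurable_psi hM j)).aestronglyMeasurable K
    (ae_of_all _ fun ω => by rw [norm_star]; exact hK _ (hM.isRDO ω) j)

theorem integrable_partQ [IsFiniteMeasure p] (hM : IsRRDO N ψS M) (i j : Fin d) :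
    Integrable (fun ω => partQ ψS (M ω) i j) p := by
  simp only [partQ_entry hM]
  exact (integrable_entry hM i j).sub ((integrable_star_psi hM j).const_mul _)

theorem integral_star {f : Ω → ℂ} : ∫ ω, star (f ω) ∂p = star (∫ ω, f ω ∂p) :=
  integral_conj

theorem expMat_partQ [IsFiniteMeasure p] (hM : IsRRDO N ψS M) :
    (expMat p fun ω => partQ ψS (M ω)) =
      expMat p M - ketBra ψS (expVec p fun ω => psi ψS (M ω)) := by
  ext i j
  simp only [expMat, of_apply, partQ_entry hM, Matrix.sub_apply, ketBra, vecMulVec_apply,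
    Pi.star_apply, expVec]
  rw [integral_sub (integrable_entry hM i j) ((integrable_star_psi hM j).const_mul _),
    integral_const_mul, integral_star]

theorem star_expVec_psi_dotProduct [IsProbabilityMeasure p] (hM : IsRRDO N ψS M) :
    star (expVec p fun ω => psi ψS (M ω)) ⬝ᵥ ψS = 1 := by
  have h : ∀ ω, ∑ i, star (psi ψS (M ω) i) * ψS i = 1 := fun ω =>
    star_psi_dotProduct_self (hM.isRDO ω) hM.isNorm (star_dotProduct_self_eq_one hM.normalized)
  have h2 : ∫ ω, ∑ i, star (psi ψS (M ω) i) * ψS i ∂p = 1 := by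
    simp only [h]; simp
  rw [integral_finsetSum _ fun i _ => (integrable_star_psi hM i).mul_const _] at h2
  simp only [integral_mul_const, integral_star] at h2
  exact h2

theorem integrable_matrix [IsFiniteMeasure p] (hM : IsRRDO N ψS M) :
    Integrable (fun ω i j => M ω i j) p :=
  Integrable.of_eval fun i => Integrable.of_eval fun j => integrable_entry hM i j

theorem expMat_eq_integral [IsFiniteMeasure p] (hM : IsRRDO N ψS M) :
    expMat p M = of (∫ ω, (fun i j => M ω i j) ∂p) := by
  ext i j
  rw [of_apply, eval_integral fun i => Integrable.of_eval fun j => integrable_entry hM i j,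
    eval_integral fun j => integrable_entry hM i j]
  rfl

/-- Pushing forward the outer measure avoids any measurability of `s`, here the ergodic set. -/
theorem exists_mem_forall_nhds_pos {X : Type*} [TopologicalSpace X] [SecondCountableTopology X]
    {M : Ω → X} {s : Set X} (h : 0 < p {ω | M ω ∈ s}) : ∃ A ∈ s, ∀ U ∈ 𝓝 A, 0 < p (M ⁻¹' U) := by
  have h' : OuterMeasure.map M p.toOuterMeasure s ≠ 0 := by
    rw [OuterMeasure.map_apply]; exact h.ne'
  obtain ⟨A, hA, hU⟩ := exists_mem_forall_mem_nhdsWithin_pos_measure h'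
  refine ⟨A, hA, fun U hUA => ?_⟩
  have := hU U (mem_nhdsWithin_of_mem_nhds hUA)
  rwa [OuterMeasure.map_apply] at this

theorem isRDO_expMat [IsProbabilityMeasure p] (hM : IsRRDO N ψS M) : IsRDO N ψS (expMat p M) := by
  rw [expMat_eq_integral hM]
  exact (convex_setOf_isRDO N ψS).integral_mem (isClosed_setOf_isRDO N ψS)
    (ae_of_all _ hM.isRDO) (integrable_matrix hM)

theorem measurableSet_preimage_closedBall (hM : IsRRDO N ψS M) (A : Fin d → Fin d → ℂ)
    (r : ℝ) : MeasurableSet ((fun ω i j => M ω i j) ⁻¹' Metric.closedBall A r) := by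
  have : Measurable fun ω i j => M ω i j :=
    measurable_pi_iff.mpr fun i => measurable_pi_iff.mpr fun j => hM.measurable i j
  exact this Metric.isClosed_closedBall.measurableSet

/-- The expectation is a nontrivial convex combination of an operator close to a prescribed matrix
charged by the law of `M`, and another operator. -/
theorem exists_expMat_eq_convexCombo [IsProbabilityMeasure p] (hM : IsRRDO N ψS M)
    {A : Fin d → Fin d → ℂ} {r : ℝ}
    (hpos : 0 < p ((fun ω i j => M ω i j) ⁻¹' Metric.closedBall A r)) :
    ∃ B C : Fin d → Fin d → ℂ, ∃ c : ℝ, IsRDO N ψS (of B) ∧ IsRDO N ψS (of C) ∧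
      B ∈ Metric.closedBall A r ∧ 0 < c ∧ c ≤ 1 ∧
      expMat p M = (c : ℂ) • of B + ((1 - c : ℝ) : ℂ) • of C := by
  set F : Ω → Fin d → Fin d → ℂ := fun ω i j => M ω i j with hF
  set S := F ⁻¹' Metric.closedBall A r with hS
  have hSm : MeasurableSet S := measurableSet_preimage_closedBall hM A r
  have hint := integrable_matrix (p := p) hM
  -- Averages stay in closed convex sets, here the intersection of the reduced dynamics operators
  -- with a ball.
  have hB : (⨍ ω in S, F ω ∂p) ∈
      {B : Fin d → Fin d → ℂ | IsRDO N ψS (of B)} ∩ Metric.closedBall A r := by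
    refine ((convex_setOf_isRDO N ψS).inter (convex_closedBall A r)).set_average_mem
      ((isClosed_setOf_isRDO N ψS).inter Metric.isClosed_closedBall) hpos.ne' (by finiteness)
      ?_ hint.integrableOn
    filter_upwards [ae_restrict_mem hSm] with ω hω using ⟨hM.isRDO ω, hω⟩
  have hc : p.real Sᶜ = 1 - p.real S := by
    rw [measureReal_compl hSm]; simp
  have hsum : expMat p M =
      of (p.real S • (⨍ ω in S, F ω ∂p) + p.real Sᶜ • ⨍ ω in Sᶜ, F ω ∂p) := by
    rw [measure_smul_setAverage _ (by finiteness), measure_smul_setAverage _ (by finiteness),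
      integral_add_compl hSm hint, expMat_eq_integral hM]
  have hpos' : 0 < p.real S := ENNReal.toReal_pos hpos.ne' (by finiteness)
  -- If `Sᶜ` is null its average is the default value `0`, which need not fix `ψS`; as its weight
  -- vanishes, `C = B` serves instead.
  rcases eq_or_ne (p Sᶜ) 0 with h0 | h0
  · have h0' : p.real Sᶜ = 0 := by simp [Measure.real, h0]
    refine ⟨_, ⨍ ω in S, F ω ∂p, p.real S, hB.1, hB.1, hB.2, hpos', measureReal_le_one, ?_⟩
    rw [hsum, ← hc, h0']
    ext i j; simp
  · have hC : (⨍ ω in Sᶜ, F ω ∂p) ∈ {B : Fin d → Fin d → ℂ | IsRDO N ψS (of B)} :=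
      (convex_setOf_isRDO N ψS).set_average_mem (isClosed_setOf_isRDO N ψS) h0 (by finiteness)
        (ae_of_all _ hM.isRDO) hint.integrableOn
    refine ⟨_, _, p.real S, hB.1, hC, hB.2, hpos', measureReal_le_one, ?_⟩
    rw [hsum, ← hc, Complex.coe_smul, Complex.coe_smul]
    rfl

theorem expMat_mem_ergodicSet [IsProbabilityMeasure p] (hM : IsRRDO N ψS M)
    (hE : 0 < p {ω | M ω ∈ ergodicSet N ψS}) : expMat p M ∈ ergodicSet N ψS := by
  have h1 := star_dotProduct_self_eq_one hM.normalized
  have hψ : ψS ≠ 0 := by rintro rfl; simp at h1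
  have hT := isRDO_expMat (p := p) hM
  obtain ⟨A, hA, hU⟩ := exists_mem_forall_nhds_pos
    (M := fun ω i j => M ω i j) (s := {A : Fin d → Fin d → ℂ | of A ∈ ergodicSet N ψS}) hE
  refine mem_ergodicSet_of_forall_mem_span hT hψ hM.isNorm fun z x hz hx => ?_
  refine mem_span_of_transverseSeminorm_eq_zero hM.isNorm ?_
  by_contra hx0
  set q := transverseSeminorm N ψS
  have hq : 0 < q x := lt_of_le_of_ne (apply_nonneg q x) (Ne.symm hx0)
  -- The strict drop after `k` steps is an open condition on the matrix, so it passes from `A` to a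
  -- nearby `B`.
  obtain ⟨k, hk⟩ := ((tendsto_transverseSeminorm_pow hψ hM.isNorm hA x).eventually_lt_const
    hq).exists
  have hc : Continuous (of : (Fin d → Fin d → ℂ) → Matrix (Fin d) (Fin d) ℂ) := continuous_id
  have hopen : IsOpen {B : Fin d → Fin d → ℂ | q ((of B ^ k) *ᵥ x) < q x} :=
    isOpen_lt ((continuous_seminorm q).comp (by fun_prop)) continuous_const
  obtain ⟨r, hr, hball⟩ := Metric.nhds_basis_closedBall.mem_iff.mp (hopen.mem_nhds hk)
  obtain ⟨B, C, c, hB, hC, hBA, hc0, hc1, heq⟩ := exists_expMat_eq_convexCombo hM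
    (hU _ (Metric.closedBall_mem_nhds A hr))
  have hle := transverseSeminorm_pow_convexCombo_le hT hB hC hc0.le hc1 heq k x
  have hBk : q ((of B ^ k) *ᵥ x) < q x := hball hBA
  have hTk : ∀ n : ℕ, (expMat p M ^ n) *ᵥ x = z ^ n • x := by
    intro n
    induction n with
    | zero => simp
    | succ n ih => rw [pow_succ, ← mulVec_mulVec, hx, mulVec_smul, ih, smul_smul, pow_succ']
  rw [hTk, map_smul_eq_mul, norm_pow, hz, one_pow, one_mul] at hle
  have := mul_lt_mul_of_pos_left hBk (pow_pos hc0 k)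
  change q x ≤ c ^ k * q ((of B ^ k) *ᵥ x) + (1 - c ^ k) * q x at hle
  linarith

end RandomProduct

/-! ### A strong law of large numbers for bounded orthogonal variables -/

namespace RandomProduct

theorem norm_sub_le_mul_of_forall_succ {E : Type*} [SeminormedAddCommGroup E] {u : ℕ → E} {C : ℝ}
    (hu : ∀ n, ‖u (n + 1) - u n‖ ≤ C) (n k : ℕ) : ‖u (n + k) - u n‖ ≤ k * C := by
  induction k with
  | zero => simp
  | succ k ih =>
    have : u (n + (k + 1)) - u n = (u (n + k + 1) - u (n + k)) + (u (n + k) - u n) := by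
      rw [← add_assoc]; abel
    rw [this]
    refine (norm_add_le _ _).trans ?_
    push_cast
    linarith [hu (n + k)]

/-- A sequence with bounded increments is `o(n)` if it is along the squares. -/
theorem tendsto_norm_div_of_tendsto_norm_div_sq {E : Type*} [SeminormedAddCommGroup E]
    {u : ℕ → E} {C : ℝ} (hu : ∀ n, ‖u (n + 1) - u n‖ ≤ C)
    (h : Tendsto (fun m : ℕ => ‖u (m ^ 2)‖ / (m : ℝ) ^ 2) atTop (𝓝 0)) :
    Tendsto (fun n : ℕ => ‖u n‖ / n) atTop (𝓝 0) := by
  have hC : 0 ≤ C := (norm_nonneg _).trans (hu 0)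
  have hsqrt : Tendsto Nat.sqrt atTop atTop :=
    tendsto_atTop_atTop.mpr fun b => ⟨b * b, fun a ha => Nat.le_sqrt.mpr ha⟩
  have hlim : Tendsto (fun m : ℕ => ‖u (m ^ 2)‖ / (m : ℝ) ^ 2 + 2 * C / m) atTop (𝓝 0) := by
    simpa using h.add (tendsto_const_div_atTop_nhds_zero_nat (2 * C))
  refine squeeze_zero (fun n => by positivity) (fun n => ?_) (hlim.comp hsqrt)
  rcases Nat.eq_zero_or_pos n with rfl | hn
  · simp
  have hm : 0 < Nat.sqrt n := Nat.sqrt_pos.mpr hn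
  simp only [Function.comp]
  have h1 : (Nat.sqrt n) ^ 2 ≤ n := Nat.sqrt_le' n
  obtain ⟨k, hk⟩ := Nat.exists_eq_add_of_le h1
  -- Consecutive squares differ by `2 m + 1`.
  have h2 : k ≤ 2 * Nat.sqrt n := by
    have := Nat.sqrt_le_add n
    nlinarith
  set m := Nat.sqrt n
  have hm' : (0 : ℝ) < m := by exact_mod_cast hm
  have hn' : (0 : ℝ) < n := by exact_mod_cast hn
  have h1' : (m : ℝ) ^ 2 ≤ n := by exact_mod_cast h1
  have h2' : (k : ℝ) ≤ 2 * m := by exact_mod_cast h2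
  have h3 : ‖u n‖ ≤ ‖u (m ^ 2)‖ + 2 * m * C := by
    have h4 := norm_sub_le_mul_of_forall_succ hu (m ^ 2) k
    rw [← hk] at h4
    have h5 := norm_le_norm_add_norm_sub' (u n) (u (m ^ 2))
    have h6 := mul_le_mul_of_nonneg_right h2' hC
    linarith
  calc ‖u n‖ / n ≤ (‖u (m ^ 2)‖ + 2 * m * C) / (m : ℝ) ^ 2 := by gcongr
    _ = ‖u (m ^ 2)‖ / (m : ℝ) ^ 2 + 2 * C / m := by field_simp

section StrongLaw

theorem norm_sum_range_le_of_forall_le {Ω : Type*} {X : ℕ → Ω → ℂ} {C : ℝ}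
    (hb : ∀ n ω, ‖X n ω‖ ≤ C) (n : ℕ) (ω : Ω) :
    ‖∑ k ∈ Finset.range n, X k ω‖ ≤ n * C := by
  simpa using norm_sum_le_of_le (Finset.range n) fun k _ => hb k ω

variable {Ω : Type*} [MeasurableSpace Ω] {μ : Measure Ω} [IsProbabilityMeasure μ]
  {X : ℕ → Ω → ℂ} {C : ℝ}

theorem integral_norm_sum_sq_le (hm : ∀ n, Measurable (X n)) (hb : ∀ n ω, ‖X n ω‖ ≤ C)
    (horth : ∀ n, ∫ ω, star (∑ k ∈ Finset.range n, X k ω) * X n ω ∂μ = 0) (n : ℕ) :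
    ∫ ω, ‖∑ k ∈ Finset.range n, X k ω‖ ^ 2 ∂μ ≤ n * C ^ 2 := by
  induction n with
  | zero => simp
  | succ n ih =>
    set S : Ω → ℂ := fun ω => ∑ k ∈ Finset.range n, X k ω with hS
    have hSm : Measurable S := Finset.measurable_sum _ fun k _ => hm k
    have hSb : ∀ ω, ‖S ω‖ ≤ n * C := norm_sum_range_le_of_forall_le hb n
    have hexp : ∀ ω, ‖∑ k ∈ Finset.range (n + 1), X k ω‖ ^ 2 =
        ‖S ω‖ ^ 2 + 2 * RCLike.re (star (S ω) * X n ω) + ‖X n ω‖ ^ 2 := fun ω => by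
      rw [Finset.sum_range_succ, norm_add_sq (𝕜 := ℂ), mul_comm (star (S ω))]
      rfl
    have hi1 : Integrable (fun ω => ‖S ω‖ ^ 2) μ :=
      Integrable.of_bound (hSm.norm.pow_const 2).aestronglyMeasurable ((n * C) ^ 2)
        (ae_of_all _ fun ω => by
          rw [norm_pow, norm_norm]; exact pow_le_pow_left₀ (norm_nonneg _) (hSb ω) 2)
    have hi3 : Integrable (fun ω => ‖X n ω‖ ^ 2) μ :=
      Integrable.of_bound ((hm n).norm.pow_const 2).aestronglyMeasurable (C ^ 2)
        (ae_of_all _ fun ω => by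
          rw [norm_pow, norm_norm]; exact pow_le_pow_left₀ (norm_nonneg _) (hb n ω) 2)
    have hi2 : Integrable (fun ω => star (S ω) * X n ω) μ :=
      Integrable.of_bound ((continuous_star.measurable.comp hSm).mul (hm n)).aestronglyMeasurable
        (n * C * C) (ae_of_all _ fun ω => by
          rw [norm_mul, norm_star]
          exact mul_le_mul (hSb ω) (hb n ω) (norm_nonneg _) ((norm_nonneg _).trans (hSb ω)))
    have hi12 : Integrable (fun ω => ‖S ω‖ ^ 2 + 2 * RCLike.re (star (S ω) * X n ω)) μ :=
      hi1.add (hi2.re.const_mul 2)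
    simp only [hexp]
    rw [integral_add hi12 hi3, integral_add hi1 (hi2.re.const_mul 2), integral_const_mul,
      integral_re hi2, horth n]
    have h3 : ∫ ω, ‖X n ω‖ ^ 2 ∂μ ≤ C ^ 2 := by
      calc ∫ ω, ‖X n ω‖ ^ 2 ∂μ ≤ ∫ _, C ^ 2 ∂μ :=
            integral_mono hi3 (integrable_const _) fun ω =>
              pow_le_pow_left₀ (norm_nonneg _) (hb n ω) 2
        _ = C ^ 2 := by simp
    push_cast
    simp only [map_zero, mul_zero, add_zero]
    linarith

/-- The strong law of large numbers for bounded random variables each of which is orthogonal to the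
sum of its predecessors. -/
theorem strong_law_of_orthogonal (hm : ∀ n, Measurable (X n)) (hb : ∀ n ω, ‖X n ω‖ ≤ C)
    (horth : ∀ n, ∫ ω, star (∑ k ∈ Finset.range n, X k ω) * X n ω ∂μ = 0) :
    ∀ᵐ ω ∂μ, Tendsto (fun n : ℕ => (n : ℂ)⁻¹ * ∑ k ∈ Finset.range n, X k ω) atTop (𝓝 0) := by
  set S : ℕ → Ω → ℂ := fun n ω => ∑ k ∈ Finset.range n, X k ω with hS
  have hSm : ∀ n, Measurable (S n) := fun n => Finset.measurable_sum _ fun k _ => hm k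
  set f : ℕ → Ω → ℝ := fun m ω => (‖S (m ^ 2) ω‖ / (m : ℝ) ^ 2) ^ 2 with hf
  have hfm : ∀ m, Measurable (f m) := fun m => ((hSm _).norm.div_const _).pow_const 2
  have hfi : ∀ m, Integrable (f m) μ := fun m =>
    Integrable.of_bound (hfm m).aestronglyMeasurable (((m ^ 2 : ℕ) * C / (m : ℝ) ^ 2) ^ 2)
      (ae_of_all _ fun ω => by
        rw [Real.norm_of_nonneg (by positivity)]
        have := norm_sum_range_le_of_forall_le hb (m ^ 2) ω
        simp only [hf]
        gcongr)
  -- Orthogonality bounds the second moment of the sum of `m ^ 2` terms by `m ^ 2 * C ^ 2`, which is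
  -- summable over `m` after division by `m ^ 4`. Along squares, Tonelli then suffices.
  have hint : ∀ m : ℕ, ∫ ω, f m ω ∂μ ≤ C ^ 2 * (1 / (m : ℝ) ^ 2) := by
    intro m
    rcases Nat.eq_zero_or_pos m with rfl | hm0
    · simp [hf]
    have hm' : (0 : ℝ) < m := by exact_mod_cast hm0
    simp only [hf, div_pow]
    rw [integral_div, div_le_iff₀ (by positivity)]
    refine (integral_norm_sum_sq_le hm hb horth (m ^ 2)).trans (le_of_eq ?_)
    push_cast
    field_simp
  have hsum : ∑' m, ∫⁻ ω, ENNReal.ofReal (f m ω) ∂μ ≠ ⊤ := by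
    have hs : Summable fun m : ℕ => C ^ 2 * (1 / (m : ℝ) ^ 2) :=
      (Real.summable_one_div_nat_pow.mpr one_lt_two).mul_left _
    refine ne_top_of_le_ne_top hs.tsum_ofReal_ne_top (ENNReal.tsum_le_tsum fun m => ?_)
    rw [← ofReal_integral_eq_lintegral_ofReal (hfi m) (ae_of_all _ fun ω => by positivity)]
    exact ENNReal.ofReal_le_ofReal (hint m)
  rw [← lintegral_tsum fun m => (hfm m).ennreal_ofReal.aemeasurable] at hsum
  filter_upwards [ae_lt_top (Measurable.tsum fun m => (hfm m).ennreal_ofReal) hsum] with ω hω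
  have h0 := ENNReal.tendsto_atTop_zero_of_tsum_ne_top hω.ne
  have h1 : Tendsto (fun m => f m ω) atTop (𝓝 0) := by
    have := (ENNReal.tendsto_toReal ENNReal.zero_ne_top).comp h0
    refine this.congr fun m => ?_
    exact ENNReal.toReal_ofReal (by positivity)
  have h2 : Tendsto (fun m : ℕ => ‖S (m ^ 2) ω‖ / (m : ℝ) ^ 2) atTop (𝓝 0) := by
    have := (Real.continuous_sqrt.tendsto 0).comp h1
    rw [Real.sqrt_zero] at this
    refine this.congr fun m => ?_
    exact Real.sqrt_sq (by positivity)
  have h3 := tendsto_norm_div_of_tendsto_norm_div_sq (u := fun n => S n ω) (C := C)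
    (fun n => by simpa [hS, Finset.sum_range_succ] using hb n ω) h2
  refine squeeze_zero_norm (fun n => le_of_eq ?_) h3
  rw [norm_mul, norm_inv, Complex.norm_natCast, inv_mul_eq_div]

end StrongLaw

end RandomProduct

/-! ### The fluctuating process as a recursion with orthogonal noise -/

namespace RandomProduct

section Past

variable {Ω : Type*} [mΩ : MeasurableSpace Ω]

/-- The σ-algebra generated by the coordinates `0, …, n`. -/
abbrev past (Ω : Type*) [mΩ : MeasurableSpace Ω] (n : ℕ) : MeasurableSpace (ℕ → Ω) :=
  ⨆ i ∈ Set.Iic n, mΩ.comap fun ω => ω i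

theorem past_le (n : ℕ) : past Ω n ≤ MeasurableSpace.pi :=
  iSup₂_le fun i _ => (measurable_pi_apply i).comap_le

theorem past_mono {m n : ℕ} (h : m ≤ n) : past Ω m ≤ past Ω n :=
  biSup_mono fun _ hi => le_trans hi h

theorem measurable_past_eval {i n : ℕ} (h : i ≤ n) : Measurable[past Ω n] fun ω : ℕ → Ω => ω i :=
  (comap_measurable _).mono
    (le_iSup₂_of_le (f := fun i (_ : i ∈ Set.Iic n) => mΩ.comap fun ω : ℕ → Ω => ω i) i h le_rfl)
    le_rfl

theorem indep_past_eval_succ (p : Measure Ω) [IsProbabilityMeasure p] (n : ℕ) :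
    ProbabilityTheory.Indep (past Ω n) (mΩ.comap fun ω => ω (n + 1))
      (Measure.infinitePi fun _ : ℕ => p) := by
  have h : ProbabilityTheory.iIndepFun (fun i (ω : ℕ → Ω) => ω i)
      (Measure.infinitePi fun _ : ℕ => p) :=
    ProbabilityTheory.iIndepFun_infinitePi (X := fun _ x => x) fun _ => measurable_id
  have h2 := ProbabilityTheory.indep_iSup_of_disjoint
    (m := fun i : ℕ => mΩ.comap fun ω : ℕ → Ω => ω i)
    (fun i => (measurable_pi_apply i).comap_le) h.iIndep
    (S := Set.Iic n) (T := {n + 1}) (by simp)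
  simpa [past] using h2

/-- Independence of the past from the next coordinate takes the place of conditional expectations.
-/
theorem integral_mul_comp_eval_succ_eq_zero (p : Measure Ω) [IsProbabilityMeasure p] {n : ℕ}
    {f : (ℕ → Ω) → ℂ} {g : Ω → ℂ} (hf : Measurable[past Ω n] f) (hg : Measurable g)
    (h0 : ∫ x, g x ∂p = 0) :
    ∫ ω, f ω * g (ω (n + 1)) ∂(Measure.infinitePi fun _ : ℕ => p) = 0 := by
  have hind : ProbabilityTheory.IndepFun f (fun ω : ℕ → Ω => g (ω (n + 1)))
      (Measure.infinitePi fun _ : ℕ => p) := by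
    rw [ProbabilityTheory.IndepFun_iff_Indep]
    refine ProbabilityTheory.indep_of_indep_of_le_left
      (ProbabilityTheory.indep_of_indep_of_le_right (indep_past_eval_succ p n) ?_) hf.comap_le
    exact (hg.comp (comap_measurable _)).comap_le
  have hgm : Measurable fun ω : ℕ → Ω => g (ω (n + 1)) := hg.comp (measurable_pi_apply _)
  have := hind.integral_mul_eq_mul_integral (hf.mono (past_le n) le_rfl).aestronglyMeasurable
    hgm.aestronglyMeasurable
  have h2 : ∫ ω, g (ω (n + 1)) ∂(Measure.infinitePi fun _ : ℕ => p) = 0 := by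
    have hmp := measurePreserving_eval_infinitePi (fun _ : ℕ => p) (n + 1)
    have hmap := integral_map (μ := Measure.infinitePi fun _ : ℕ => p) hmp.measurable.aemeasurable
      hg.aestronglyMeasurable
    rw [hmp.map_eq, h0] at hmap
    exact hmap.symm
  rw [h2, mul_zero] at this
  exact this

end Past

theorem theta_succ_apply {d : ℕ} {Ω : Type*}
    (M : Ω → Matrix (Fin d) (Fin d) ℂ) (ψS : Fin d → ℂ) (ω : ℕ → Ω) (n : ℕ) (i : Fin d) :
    theta M ψS ω (n + 1) i = ∑ j, star (M (ω (n + 1)) j i) * theta M ψS ω n j := rfl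

variable {d : ℕ} {Ω : Type*} [mΩ : MeasurableSpace Ω] {p : Measure Ω}
  {N : Seminorm ℂ (Fin d → ℂ)} {ψS : Fin d → ℂ} {M : Ω → Matrix (Fin d) (Fin d) ℂ}

theorem measurable_theta (hM : IsRRDO N ψS M) (n : ℕ) (i : Fin d) :
    Measurable[past Ω n] fun ω => theta M ψS ω n i := by
  induction n generalizing i with
  | zero => exact (measurable_psi hM i).comp (measurable_past_eval le_rfl)
  | succ n ih =>
    simp only [theta_succ_apply]
    refine Finset.measurable_sum _ fun j _ => ?_
    exact (continuous_star.measurable.comp ((hM.measurable j i).comp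
      (measurable_past_eval le_rfl))).mul ((ih j).mono (past_mono n.le_succ) le_rfl)

theorem star_dotProduct_theta (hM : IsRRDO N ψS M) (ω : ℕ → Ω) (n : ℕ) :
    star ψS ⬝ᵥ theta M ψS ω n = 1 := by
  refine star_dotProduct_eq_one_symm ?_
  induction n with
  | zero => exact star_psi_dotProduct_self (hM.isRDO _) hM.isNorm
              (star_dotProduct_self_eq_one hM.normalized)
  | succ n ih =>
    rw [theta, star_conjTranspose_mulVec_dotProduct, (hM.isRDO _).invariant, ih]

/-- The adjoints in `theta` need not contract `N`; moved onto the test vector `x`, they become the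
`M ω`, which do. -/
theorem exists_norm_star_theta_dotProduct_le (hM : IsRRDO N ψS M) :
    ∃ K : ℝ, 0 ≤ K ∧ ∀ ω n x, ‖star (theta M ψS ω n) ⬝ᵥ x‖ ≤ K * N x := by
  obtain ⟨K, hK0, hK⟩ := star_psi_dotProduct_le hM.isNorm ψS
  refine ⟨K, hK0, fun ω n => ?_⟩
  induction n with
  | zero => exact hK _ (hM.isRDO _)
  | succ n ih =>
    intro x
    rw [theta, star_conjTranspose_mulVec_dotProduct]
    exact (ih _).trans (mul_le_mul_of_nonneg_left ((hM.isRDO _).contraction x) hK0)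

theorem norm_apply_le_of_star_dotProduct_le {K : ℝ} {v : Fin d → ℂ}
    (h : ∀ x, ‖star v ⬝ᵥ x‖ ≤ K * N x) (i : Fin d) : ‖v i‖ ≤ K * N (Pi.single i 1) := by
  have := h (Pi.single i 1)
  rwa [dotProduct_single_one, Pi.star_apply, norm_star] at this

/-- The fluctuation of `θ` about its conditional expectation given the past. -/
noncomputable def thetaIncrement (p : Measure Ω) (M : Ω → Matrix (Fin d) (Fin d) ℂ)
    (ψS : Fin d → ℂ) (n : ℕ) (ω : ℕ → Ω) : Fin d → ℂ :=
  theta M ψS ω (n + 1) - (expMat p M)ᴴ *ᵥ theta M ψS ω n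

theorem thetaIncrement_apply (n : ℕ) (ω : ℕ → Ω) (i : Fin d) :
    thetaIncrement p M ψS n ω i =
      ∑ j, theta M ψS ω n j * star (M (ω (n + 1)) j i - expMat p M j i) := by
  rw [thetaIncrement, Pi.sub_apply, theta_succ_apply, mulVec, dotProduct,
    ← Finset.sum_sub_distrib]
  refine Finset.sum_congr rfl fun j _ => ?_
  rw [conjTranspose_apply, star_sub]
  ring

theorem measurable_thetaIncrement (hM : IsRRDO N ψS M) (n : ℕ) (i : Fin d) :
    Measurable[past Ω (n + 1)] fun ω => thetaIncrement p M ψS n ω i := by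
  simp only [thetaIncrement, Pi.sub_apply, mulVec, dotProduct]
  refine (measurable_theta hM (n + 1) i).sub (Finset.measurable_sum _ fun j _ => ?_)
  exact ((measurable_theta hM n j).mono (past_mono n.le_succ) le_rfl).const_mul _

theorem exists_norm_thetaIncrement_le [IsProbabilityMeasure p] (hM : IsRRDO N ψS M) (i : Fin d) :
    ∃ C : ℝ, ∀ n ω, ‖thetaIncrement p M ψS n ω i‖ ≤ C := by
  obtain ⟨K, hK0, hK⟩ := exists_norm_star_theta_dotProduct_le hM
  refine ⟨K * N (Pi.single i 1) + K * N (Pi.single i 1), fun n ω => ?_⟩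
  refine (norm_sub_le _ _).trans (add_le_add ?_ ?_)
  · exact norm_apply_le_of_star_dotProduct_le (hK ω (n + 1)) i
  · refine norm_apply_le_of_star_dotProduct_le (fun x => ?_) i
    rw [star_conjTranspose_mulVec_dotProduct]
    exact (hK ω n _).trans (mul_le_mul_of_nonneg_left ((isRDO_expMat hM).contraction x) hK0)

theorem integral_star_sum_mul_thetaIncrement [IsProbabilityMeasure p] (hM : IsRRDO N ψS M)
    (i : Fin d) (n : ℕ) :
    ∫ ω, star (∑ k ∈ Finset.range n, thetaIncrement p M ψS k ω i) * thetaIncrement p M ψS n ω i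
      ∂(Measure.infinitePi fun _ : ℕ => p) = 0 := by
  set S : (ℕ → Ω) → ℂ := fun ω => ∑ k ∈ Finset.range n, thetaIncrement p M ψS k ω i with hS
  -- Increment `k` depends on the coordinates up to `k + 1`, and `k < n`.
  have hSm : Measurable[past Ω n] S := Finset.measurable_sum _ fun k hk =>
    (measurable_thetaIncrement hM k i).mono (past_mono (Finset.mem_range.mp hk)) le_rfl
  have hf : ∀ j, Measurable[past Ω n] fun ω => star (S ω) * theta M ψS ω n j := fun j =>
    (continuous_star.measurable.comp hSm).mul (measurable_theta hM n j)
  have hg : ∀ j, Measurable fun x => star (M x j i - expMat p M j i) := fun j =>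
    continuous_star.measurable.comp ((hM.measurable j i).sub_const _)
  have h0 : ∀ j, ∫ x, star (M x j i - expMat p M j i) ∂p = 0 := fun j => by
    rw [integral_star, integral_sub (integrable_entry hM j i) (integrable_const _)]
    simp [expMat]
  obtain ⟨K, hK0, hK⟩ := exists_norm_star_theta_dotProduct_le hM
  obtain ⟨L, hL0, hL⟩ := IsRDO.exists_norm_entry_le hM.isNorm
  obtain ⟨C, hC⟩ := exists_norm_thetaIncrement_le (p := p) hM i
  have hSb := norm_sum_range_le_of_forall_le (X := fun n ω => thetaIncrement p M ψS n ω i) hC n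
  have hint : ∀ j, Integrable
      (fun ω => star (S ω) * theta M ψS ω n j * star (M (ω (n + 1)) j i - expMat p M j i))
      (Measure.infinitePi fun _ : ℕ => p) := fun j => by
    refine Integrable.of_bound (((hf j).mono (past_le n) le_rfl).mul
      ((hg j).comp (measurable_pi_apply (n + 1)))).aestronglyMeasurable
      (n * C * (K * N (Pi.single j 1)) * (L + L)) (ae_of_all _ fun ω => ?_)
    rw [norm_mul, norm_mul, norm_star, norm_star]
    have h1 := hSb ω
    have h2 := norm_apply_le_of_star_dotProduct_le (hK ω n) j
    have h3 : ‖M (ω (n + 1)) j i - expMat p M j i‖ ≤ L + L := (norm_sub_le _ _).trans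
      (add_le_add (hL _ _ (hM.isRDO _) j i) (hL _ _ (isRDO_expMat hM) j i))
    have h4 : 0 ≤ n * C := (norm_nonneg _).trans h1
    have h5 : 0 ≤ K * N (Pi.single j 1) := (norm_nonneg _).trans h2
    exact mul_le_mul (mul_le_mul h1 h2 (norm_nonneg _) h4) h3 (norm_nonneg _)
      (mul_nonneg h4 h5)
  simp only [thetaIncrement_apply (n := n), Finset.mul_sum, ← mul_assoc]
  rw [integral_finsetSum _ fun j _ => hint j]
  exact Finset.sum_eq_zero fun j _ =>
    integral_mul_comp_eval_succ_eq_zero p (hf j) (hg j) (h0 j)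

theorem ae_tendsto_mean_thetaIncrement [IsProbabilityMeasure p] (hM : IsRRDO N ψS M) :
    ∀ᵐ ω ∂(Measure.infinitePi fun _ : ℕ => p),
      Tendsto (fun n : ℕ => (n : ℂ)⁻¹ • ∑ k ∈ Finset.range n, thetaIncrement p M ψS k ω) atTop
        (𝓝 0) := by
  have h : ∀ i, ∀ᵐ ω ∂(Measure.infinitePi fun _ : ℕ => p),
      Tendsto (fun n : ℕ => (n : ℂ)⁻¹ * ∑ k ∈ Finset.range n, thetaIncrement p M ψS k ω i) atTop
        (𝓝 0) := fun i => by
    obtain ⟨C, hC⟩ := exists_norm_thetaIncrement_le (p := p) hM i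
    exact strong_law_of_orthogonal
      (fun n => (measurable_thetaIncrement hM n i).mono (past_le _) le_rfl) hC
      (integral_star_sum_mul_thetaIncrement hM i)
  filter_upwards [ae_all_iff.mpr h] with ω hω
  rw [tendsto_pi_nhds]
  intro i
  simpa using hω i

/-- The Cesàro means of `θ` are asymptotically invariant under the adjoint of the expectation
of `M`. -/
theorem ae_tendsto_mean_theta_sub [IsProbabilityMeasure p] (hM : IsRRDO N ψS M) :
    ∀ᵐ ω ∂(Measure.infinitePi fun _ : ℕ => p),
      Tendsto (fun n : ℕ => ((n : ℂ)⁻¹ • ∑ k ∈ Finset.range n, theta M ψS ω k) -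
        (expMat p M)ᴴ *ᵥ ((n : ℂ)⁻¹ • ∑ k ∈ Finset.range n, theta M ψS ω k)) atTop (𝓝 0) := by
  filter_upwards [ae_tendsto_mean_thetaIncrement (p := p) hM] with ω hω
  obtain ⟨K, hK0, hK⟩ := exists_norm_star_theta_dotProduct_le hM
  have hbd : Tendsto (fun n : ℕ => (n : ℂ)⁻¹ • (theta M ψS ω 0 - theta M ψS ω n)) atTop (𝓝 0) := by
    rw [tendsto_pi_nhds]
    intro i
    refine squeeze_zero_norm (fun n => ?_) (tendsto_const_div_atTop_nhds_zero_nat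
      (K * N (Pi.single i 1) + K * N (Pi.single i 1)))
    rw [Pi.smul_apply, norm_smul, norm_inv, Complex.norm_natCast, inv_mul_eq_div, Pi.sub_apply]
    gcongr
    exact (norm_sub_le _ _).trans
      (add_le_add (norm_apply_le_of_star_dotProduct_le (hK ω 0) i)
        (norm_apply_le_of_star_dotProduct_le (hK ω n) i))
  have hsum := hω.add hbd
  rw [add_zero] at hsum
  refine hsum.congr fun n => ?_
  have h1 := Finset.sum_range_sub (fun k => theta M ψS ω k) n
  -- The shift from `θ (k + 1)` to `θ k` telescopes to a boundary term, which `hbd` makes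
  -- negligible.
  have h2 : ∑ k ∈ Finset.range n, thetaIncrement p M ψS k ω =
      (theta M ψS ω n - theta M ψS ω 0) + (∑ k ∈ Finset.range n, theta M ψS ω k -
        (expMat p M)ᴴ *ᵥ ∑ k ∈ Finset.range n, theta M ψS ω k) := by
    rw [← h1, mulVec_sum, ← Finset.sum_sub_distrib, ← Finset.sum_add_distrib]
    refine Finset.sum_congr rfl fun k _ => ?_
    rw [thetaIncrement]; abel
  rw [h2, mulVec_smul, ← smul_add, ← smul_sub]
  congr 1
  abel

theorem star_dotProduct_mean_theta (hM : IsRRDO N ψS M) (ω : ℕ → Ω) {n : ℕ} (hn : n ≠ 0) :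
    star ψS ⬝ᵥ ((n : ℂ)⁻¹ • ∑ k ∈ Finset.range n, theta M ψS ω k) = 1 := by
  have hn' : (n : ℂ) ≠ 0 := by exact_mod_cast hn
  rw [dotProduct_smul, dotProduct_sum]
  simp [star_dotProduct_theta hM, hn']

theorem ae_tendsto_mean_theta [IsProbabilityMeasure p] (hM : IsRRDO N ψS M)
    (hU : IsUnit (1 - (expMat p fun ω => partQ ψS (M ω))ᴴ)) :
    ∀ᵐ ω ∂(Measure.infinitePi fun _ : ℕ => p),
      Tendsto (fun n : ℕ => (n : ℂ)⁻¹ • ∑ k ∈ Finset.range n, theta M ψS ω k) atTop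
        (𝓝 ((1 - (expMat p fun ω => partQ ψS (M ω))ᴴ)⁻¹ *ᵥ
          (expVec p fun ω => psi ψS (M ω)))) := by
  filter_upwards [ae_tendsto_mean_theta_sub (p := p) hM] with ω hω
  set U := 1 - (expMat p fun ω => partQ ψS (M ω))ᴴ with hUdef
  have h1 := hω.add_const (expVec p fun ω => psi ψS (M ω))
  rw [zero_add] at h1
  have hcont : Continuous fun v : Fin d → ℂ => U⁻¹ *ᵥ v := by fun_prop
  refine ((hcont.tendsto _).comp h1).congr' ?_
  -- The empty mean at `n = 0` pairs to `0` with `ψS`, not to `1`.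
  filter_upwards [eventually_ne_atTop 0] with n hn
  rw [Function.comp, ← one_sub_conjTranspose_mulVec _ _ (star_dotProduct_mean_theta hM ω hn),
    ← expMat_partQ hM, mulVec_mulVec, nonsing_inv_mul _ ((isUnit_iff_isUnit_det _).mp hU),
    one_mulVec]

end RandomProduct

/-! ### Assembly of the theorem -/

open RandomProduct in
theorem theorem1p2 {d : ℕ} {Ω : Type*} [MeasurableSpace Ω] (p : Measure Ω) [IsProbabilityMeasure p]
    (N : Seminorm ℂ (Fin d → ℂ)) (ψS : Fin d → ℂ) (M : Ω → Matrix (Fin d) (Fin d) ℂ)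
    (hM : IsRRDO N ψS M)
    (hE : 0 < p {ω | M ω ∈ ergodicSet N ψS}) :
    -- the expectations below exist
    (∀ i j, Integrable (fun ω => M ω i j) p) ∧
    (∀ i j, Integrable (fun ω => partQ ψS (M ω) i j) p) ∧
    (∀ i, Integrable (fun ω => psi ψS (M ω) i) p) ∧
    expMat p M ∈ ergodicSet N ψS ∧
    IsUnit (1 - (expMat p fun ω => partQ ψS (M ω))ᴴ) ∧
    ∃ θ : Fin d → ℂ,
      θ = (1 - (expMat p fun ω => partQ ψS (M ω))ᴴ)⁻¹ *ᵥ (expVec p fun ω => psi ψS (M ω)) ∧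
      θ = (spectralProj (expMat p M) 1)ᴴ *ᵥ (expVec p fun ω => psi ψS (M ω)) ∧
      θ = (spectralProj (expMat p M) 1)ᴴ *ᵥ ψS ∧
      ∀ᵐ ω ∂(Measure.infinitePi fun _ : ℕ => p),
        Tendsto (fun n : ℕ => (n : ℂ)⁻¹ • ∑ k ∈ Finset.range n, theta M ψS ω k) atTop (𝓝 θ) := by
  have h1 := star_dotProduct_self_eq_one hM.normalized
  have hT := expMat_mem_ergodicSet hM hE
  have hv := star_expVec_psi_dotProduct (p := p) hM
  have hU : IsUnit (1 - (expMat p fun ω => partQ ψS (M ω))ᴴ) := by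
    rw [expMat_partQ hM]
    exact isUnit_one_sub_conjTranspose hT hM.isNorm hv
  refine ⟨integrable_entry hM, integrable_partQ hM, integrable_psi hM, hT, hU, _, rfl, ?_, ?_,
    ae_tendsto_mean_theta hM hU⟩
  all_goals
    have hinv : (1 - (expMat p fun ω => partQ ψS (M ω))ᴴ)⁻¹ *ᵥ (expVec p fun ω => psi ψS (M ω)) =
        psi ψS (expMat p M) := by
      -- `psi ψS (expMat p M)` is fixed by the adjoint of the expectation and pairs to `1` with
      -- `ψS`, so `1 - 𝔼[M_Q]ᴴ` maps it to `𝔼ψ`.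
      have hφ := one_sub_conjTranspose_mulVec (expMat p M) (expVec p fun ω => psi ψS (M ω))
        (star_dotProduct_eq_one_symm (star_psi_dotProduct_self hT.1 hM.isNorm h1))
      rw [conjTranspose_mulVec_psi hT.1 hM.isNorm, sub_self, zero_add, ← expMat_partQ hM] at hφ
      rw [← hφ, mulVec_mulVec, nonsing_inv_mul _ ((isUnit_iff_isUnit_det _).mp hU), one_mulVec]
    rw [hinv]
  · exact (conjTranspose_spectralProj_mulVec hT hM.isNorm h1
      (star_dotProduct_eq_one_symm hv)).symm
  · rfl
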